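/- Let $\mathcal H$ be a class of hypergraphs of bounded fractional hypertree width, i.e. there is a constant $r$ such that every $H\in\mathcal H$ has a fractional hypertree decomposition of width at most $r$: a tree decomposition $(T,(B_t)_{t\in V(T)})$ of $H$ together with maps $\gamma_t:E(H)\to[0,\infty)$ such that, for every node $t$, $\sum_{e\in E(H)}\gamma_t(e)\le r$ and $\sum_{e\ni v}\gamma_t(e)\ge 1$ for all $v\in B_t$. For a finite relational structure $A$ (over a finite vocabulary $\tau$ of relation symbols), let $H_A$ be the hypergraph whose vertices are the elements of $A$ and whose hyperedges are all sets $\{a_1,\dots,a_k\}$ such that $(a_1,\dots,a_k)$ is a tuple in some relation of $A$, and let $\|A\|=|\tau|+|A|+\sum_{R\in\tau}\operatorname{ar}(R)\cdot|R^A|$. Let $\mathrm{EMB}(\mathcal H)$ be the (promise) problem of deciding, for finite structures $A,B$ over the same vocabulary, with $H_A\in\mathcal H$ and all relations given by lists of their tuples, whether there is an embedding of $A$ into $B$, i.e. an injective map $A\to B$ that preserves membership in all relations. Theorem. $\mathrm{EMB}(\mathcal H)$, parameterized by $k=\|A\|$, is fixed-parameter tractable, i.e. solvable in time $f(k)\cdot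 n^{O(1)}$, where $n=\|A\|+\|B\|$ and $f$ is a computable function. More precisely, there is an algorithm that, given a structure $A$ with $H_A\in\mathcal H$ and a structure $B$, decides whether there is an embedding of $A$ into $B$ in time $2^{\|A\|^{O(1)}}\cdot\|B\|^{O(1)}$. -/

import Mathlib

open scoped ENNReal NNReal

namespace EmbFPT

/-! ### Fractional hypertree width

Hypergraphs are Mathlib's `Hypergraph V`: a set of vertices in `V` and a set of hyperedges. -/

/-- A fractional hypertree decomposition of `H`: a finite tree, a bag of vertices and a fractional
guard (a weighting of the hyperedges) at every node. A vertex has to occur in some bag, because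
`SimpleGraph.Connected` includes non-emptiness; so a hypergraph with an isolated vertex, which no
guard can block, has no such decomposition. -/
structure FracHypertreeDecomp {V : Type} (H : Hypergraph V) where
  /-- the nodes of the tree -/
  Node : Type
  finite_node : Finite Node
  /-- the tree -/
  tree : SimpleGraph Node
  isTree : tree.IsTree
  /-- the bags -/
  bag : Node → Set V
  bag_subset : ∀ t, bag t ⊆ H.vertexSet
  edge_covered : ∀ e ∈ H.edgeSet, ∃ t, e ⊆ bag t
  connected : ∀ v ∈ H.vertexSet, (tree.induce {t | v ∈ bag t}).Connected
  /-- the fractional guards -/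
  guard : Node → H.edgeSet → ℝ≥0
  /-- every vertex of a bag is blocked by the guard of the bag -/
  blocked : ∀ t, ∀ v ∈ bag t, 1 ≤ ∑' e : {e : H.edgeSet // v ∈ (e : Set V)}, (guard t e.1 : ℝ≥0∞)

/-- The width of a decomposition: the largest weight of a guard. -/
noncomputable def FracHypertreeDecomp.width {V : Type} {H : Hypergraph V}
    (D : FracHypertreeDecomp H) : ℝ≥0∞ :=
  ⨆ t : D.Node, ∑' e : H.edgeSet, (D.guard t e : ℝ≥0∞)

/-- The fractional hypertree width (it is `⊤` if there is no decomposition of finite width). -/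
noncomputable def fhw {V : Type} (H : Hypergraph V) : ℝ≥0∞ :=
  ⨅ D : FracHypertreeDecomp H, D.width

/-- A class of hypergraphs. -/
abbrev HypergraphClass : Type 1 := (V : Type) → Set (Hypergraph V)

/-- The class has bounded fractional hypertree width. -/
def HypergraphClass.BoundedFHW (𝓗 : HypergraphClass) : Prop :=
  ∃ r : ℝ≥0, ∀ (V : Type) (H : Hypergraph V), H ∈ 𝓗 V → fhw H ≤ r

/-! ### Relational structures

A vocabulary is a `FirstOrder.Language` without function symbols, a structure is Mathlib's
`FirstOrder.Language.Structure`, and homomorphisms are those of `FirstOrder.Language.Hom`: maps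
that preserve membership in all relations. -/

/-- The relation symbols of a vocabulary, with their arities. -/
abbrev RelSym (L : FirstOrder.Language.{0, 0}) : Type := Σ n, L.Relations n

/-- The hypergraph of a structure: the vertices are the elements, and the hyperedges are the sets
of the entries of the tuples in the relations. -/
def hypergraphOf (L : FirstOrder.Language.{0, 0}) (A : Type) [L.Structure A] : Hypergraph A where
  vertexSet := Set.univ
  edgeSet := {s | ∃ (R : RelSym L) (a : Fin R.1 → A),
    FirstOrder.Language.Structure.RelMap R.2 a ∧ s = Set.range a}
  subset_vertexSet_of_mem_edgeSet' := fun _ _ => Set.subset_univ _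

/-- The size `‖A‖` of a finite structure over a finite relational vocabulary: the number of
relation symbols, plus the number of elements, plus, for every relation, its number of tuples
times its arity. -/
noncomputable def structSize (L : FirstOrder.Language.{0, 0}) (A : Type) [L.Structure A] : ℕ :=
  Nat.card (RelSym L) + Nat.card A +
    ∑ᶠ R : RelSym L, R.1 * Nat.card {a : Fin R.1 → A // FirstOrder.Language.Structure.RelMap R.2 a}

/-! ### The model of computation

Programs that manipulate binary trees (as in Jones's language WHILE, or pure Lisp). Every operation
moves or tests a constant number of pointers, or allocates one cell, and costs one step. Hence
the step count agrees with the running time of Turing machines or of random access machines up to a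
polynomial. -/

/-- Binary trees, the data of the programs. -/
inductive Sexp : Type
  | nil : Sexp
  | cons : Sexp → Sexp → Sexp

/-- Programs; each of them computes a partial function from trees to trees. -/
inductive Prog : Type
  /-- the constant `nil` -/
  | zero : Prog
  /-- the identity -/
  | ident : Prog
  /-- the left subtree -/
  | fst : Prog
  /-- the right subtree -/
  | snd : Prog
  /-- run `f` and `g` on the input and make a tree of the two results -/
  | pair (f g : Prog) : Prog
  /-- run `f`, then `g` on the result -/
  | seq (f g : Prog) : Prog
  /-- run the test `c`; if its result is not `nil`, run `f`, otherwise run `g` -/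
  | ite (c f g : Prog) : Prog
  /-- as long as the result of the test `c` is not `nil`, replace the current tree by the result
  of `f` -/
  | loop (c f : Prog) : Prog

/-- `Runs p x y n`: on input `x` the program `p` halts with output `y` after `n` steps. -/
inductive Runs : Prog → Sexp → Sexp → ℕ → Prop
  | zero (x : Sexp) : Runs .zero x .nil 1
  | ident (x : Sexp) : Runs .ident x x 1
  | fst_nil : Runs .fst .nil .nil 1
  | fst_cons (x y : Sexp) : Runs .fst (.cons x y) x 1
  | snd_nil : Runs .snd .nil .nil 1
  | snd_cons (x y : Sexp) : Runs .snd (.cons x y) y 1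
  | pair {f g : Prog} {x y z : Sexp} {m n : ℕ} :
      Runs f x y m → Runs g x z n → Runs (.pair f g) x (.cons y z) (m + n + 1)
  | seq {f g : Prog} {x y z : Sexp} {m n : ℕ} :
      Runs f x y m → Runs g y z n → Runs (.seq f g) x z (m + n + 1)
  | ite_true {c f g : Prog} {x a b y : Sexp} {m n : ℕ} :
      Runs c x (.cons a b) m → Runs f x y n → Runs (.ite c f g) x y (m + n + 1)
  | ite_false {c f g : Prog} {x y : Sexp} {m n : ℕ} :
      Runs c x .nil m → Runs g x y n → Runs (.ite c f g) x y (m + n + 1)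
  | loop_stop {c f : Prog} {x : Sexp} {m : ℕ} :
      Runs c x .nil m → Runs (.loop c f) x x (m + 1)
  | loop_step {c f : Prog} {x a b y z : Sexp} {m n k : ℕ} :
      Runs c x (.cons a b) m → Runs f x y n → Runs (.loop c f) y z k →
        Runs (.loop c f) x z (m + n + k + 1)

/-- Programs are deterministic: output and number of steps are unique. -/
theorem Runs.deterministic {p : Prog} {x y z : Sexp} {m n : ℕ} (h : Runs p x y m)
    (h' : Runs p x z n) : y = z ∧ m = n := by
  induction h generalizing z n <;> cases h' <;> grind

/-! ### Parameterized problems -/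

/-- A parameterized decision problem. Only the given instances are possible inputs, so this is a
promise problem: nothing is required of a program on other inputs. -/
structure ParamProblem where
  /-- the instances -/
  Instance : Type 1
  /-- the trees that represent a given instance as an input of a program -/
  Represents : Instance → Sexp → Prop
  /-- the size of an instance -/
  size : Instance → ℕ
  /-- the parameter -/
  param : Instance → ℕ
  /-- the instances to be answered with `yes` -/
  IsYes : Instance → Prop

/-- The program decides the problem in the given time: on every representation of every instance
it halts within the time bound, and its output is not `nil` if and only if the answer is `yes`. -/
def ParamProblem.DecidedBy (P : ParamProblem) (p : Prog) (time : P.Instance → ℕ) : Prop :=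
  ∀ (I : P.Instance) (x : Sexp), P.Represents I x →
    ∃ (y : Sexp) (n : ℕ), Runs p x y n ∧ n ≤ time I ∧ (y ≠ .nil ↔ P.IsYes I)

/-- Fixed-parameter tractability: solvable in time `f(k) · n ^ O(1)` with a computable `f`, where
`k` is the parameter and `n` the size (`n + 1` is used so that size `0` does no harm). -/
def ParamProblem.FPT (P : ParamProblem) : Prop :=
  ∃ (p : Prog) (f : ℕ → ℕ) (c : ℕ), Computable f ∧
    P.DecidedBy p fun I => f (P.param I) * (P.size I + 1) ^ c

/-! ### The representation of structures as inputs -/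

/-- Numbers in unary. -/
def Sexp.num : ℕ → Sexp
  | 0 => .nil
  | n + 1 => .cons .nil (Sexp.num n)

/-- Lists of trees. -/
def Sexp.list : List Sexp → Sexp
  | [] => .nil
  | x :: l => .cons x (Sexp.list l)

/-- The tree `x` represents the structure `A`, where `syms` lists the relation symbols: it consists
of the number of elements and, for each symbol in turn, a list of the tuples in the relation,
without repetition and in any order. A tuple is the list of its entries, given by their
numbers in some enumeration of `A`. -/
def RepresentsStructure (L : FirstOrder.Language.{0, 0}) (syms : List (RelSym L))
    (A : Type) [L.Structure A] (x : Sexp) : Prop :=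
  ∃ (k : ℕ) (e : A ≃ Fin k) (tuples : (R : RelSym L) → List (Fin R.1 → A)),
    (∀ R, (tuples R).Nodup) ∧
    (∀ R a, a ∈ tuples R ↔ FirstOrder.Language.Structure.RelMap R.2 a) ∧
    x = .cons (.num k) (.list (syms.map fun R =>
      .list ((tuples R).map fun a => .list (List.ofFn fun i => .num (e (a i) : ℕ)))))

/-- An instance of the embedding problem: two finite structures over the same finite relational
vocabulary, where the hypergraph of the first structure belongs to `𝓗`. -/
structure EmbInstance (𝓗 : HypergraphClass) where
  /-- the vocabulary -/
  L : FirstOrder.Language.{0, 0}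
  relational : L.IsRelational
  finite_sym : Finite (RelSym L)
  /-- the structure to be embedded -/
  A : Type
  /-- the target structure -/
  B : Type
  [strA : L.Structure A]
  [strB : L.Structure B]
  finite_A : Finite A
  finite_B : Finite B
  mem_class : hypergraphOf L A ∈ 𝓗 A

attribute [instance] EmbInstance.strA EmbInstance.strB

/-- The size `‖A‖` of the structure to be embedded. -/
noncomputable def EmbInstance.sizeA {𝓗 : HypergraphClass} (I : EmbInstance 𝓗) : ℕ :=
  structSize I.L I.A

/-- The size `‖B‖` of the target structure. -/
noncomputable def EmbInstance.sizeB {𝓗 : HypergraphClass} (I : EmbInstance 𝓗) : ℕ :=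
  structSize I.L I.B

/-- The problem `EMB(𝓗)`, parameterized by `‖A‖`: is there an embedding (that is, an injective
homomorphism) from `A` to `B`? The inputs list the relation symbols of both structures in the same
order, which can be any order. -/
noncomputable def EMB (𝓗 : HypergraphClass) : ParamProblem where
  Instance := EmbInstance 𝓗
  Represents I x := ∃ (syms : List (RelSym I.L)) (a b : Sexp),
    syms.Nodup ∧ (∀ R, R ∈ syms) ∧ RepresentsStructure I.L syms I.A a ∧
      RepresentsStructure I.L syms I.B b ∧ x = .cons a b
  size I := I.sizeA + I.sizeB
  param I := I.sizeA
  IsYes I := ∃ h : FirstOrder.Language.Hom I.L I.A I.B, Function.Injective h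

end EmbFPT

namespace EmbFPT

/-! ### Encodings and polynomial bounds -/

/-! The proof combines colour coding, the fractional edge cover bound and pairwise consistency. Let
`A` have `k` elements and `B` have `n`.

Injectivity is turned into constraints on single elements. For every `k`-subset of the target, some
hash function `b ↦ a * b % m % q` with `m, a < 2 * n + 3` and `q = 2 * (k + 1) ^ 2` is injective on
it (`exists_hash_injective`: Bertrand's postulate and a union bound). So an injective homomorphism
`h` exists if and only if, for some such hash function and some colouring `c` of the `q` hash values
by elements of `A`, there is a homomorphism `h` with `c (hash (h v)) = v` for all `v`. This equation
forces injectivity, and the number of colourings depends only on `k`.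

What remains is a constraint satisfaction problem on `A`, and no decomposition has to be computed
for it. For every subset of `A` the partial maps compatible with each single constraint are listed,
and a list is discarded if it exceeds `(N + 1) ^ r`, where `N` is the number of tuples of `B`. Then
maps that agree with no map of some other list are deleted until nothing changes (`consFix`). The
restrictions of a true solution survive, whichever subsets are kept (`solvable_of_function`).
Conversely, the fractional edge cover bound `card_le_prod_card_restrict_rpow` shows that a subset of
a bag of a decomposition of width at most `r` has at most `(N + 1) ^ r` compatible maps
(`length_partials_le_pow`). So all bags are among the kept subsets, and non-empty pairwise
consistent lists on the bags are glued along the tree (`exists_glue`, `exists_of_solvable`). A tuple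
of `A` lies inside one bag, so the glued map is a homomorphism.

For the running time, all ingredients are polynomial-time functions once the unary number `padSize
k`, a bound on the number of words over `k + 1` letters, is part of the input. That number is
computed first, in time polynomial in its value (`exists_prog_two_pow`). -/

/-- The number of nodes of a tree. -/
def Sexp.size : Sexp → ℕ
  | .nil => 1
  | .cons x y => x.size + y.size + 1

theorem Sexp.size_pos (x : Sexp) : 0 < x.size := by cases x <;> simp [Sexp.size]

/-- Types whose elements are represented by trees. -/
class Enc (α : Type) where
  /-- the tree that represents an element -/
  enc : α → Sexp

open Enc (enc)

instance : Enc Unit := ⟨fun _ => .nil⟩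
instance : Enc Bool := ⟨fun b => cond b (.cons .nil .nil) .nil⟩
instance : Enc ℕ := ⟨Sexp.num⟩

instance {α β : Type} [Enc α] [Enc β] : Enc (α × β) := ⟨fun p => .cons (enc p.1) (enc p.2)⟩

instance {α : Type} [Enc α] : Enc (List α) := ⟨fun l => .list (l.map enc)⟩

/-- The size of the representation of an element. -/
def sz {α : Type} [Enc α] (a : α) : ℕ := (enc a).size

variable {α β γ σ δ : Type} [Enc α] [Enc β] [Enc γ] [Enc σ] [Enc δ]

@[simp] theorem enc_cons (a : α) (l : List α) : enc (a :: l) = .cons (enc a) (enc l) := rfl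
@[simp] theorem enc_pair (a : α) (b : β) : enc (a, b) = .cons (enc a) (enc b) := rfl
@[simp] theorem enc_true : enc true = .cons .nil .nil := rfl
@[simp] theorem enc_unit (u : Unit) : enc u = .nil := rfl
@[simp] theorem enc_succ (n : ℕ) : enc (n + 1) = .cons .nil (enc n) := rfl

theorem sz_pos (a : α) : 0 < sz a := Sexp.size_pos _
@[simp] theorem sz_nil : sz ([] : List α) = 1 := rfl
@[simp] theorem sz_cons (a : α) (l : List α) : sz (a :: l) = sz a + sz l + 1 := rfl
@[simp] theorem sz_pair (a : α) (b : β) : sz (a, b) = sz a + sz b + 1 := rfl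
@[simp] theorem sz_unit (u : Unit) : sz u = 1 := rfl

@[simp] theorem sz_nat (n : ℕ) : sz n = 2 * n + 1 := by
  induction n with
  | zero => rfl
  | succ n ih => rw [sz] at *; simp only [enc_succ, Sexp.size, ih]; ring

@[simp] theorem sz_append (l m : List α) : sz (l ++ m) + 1 = sz l + sz m := by
  induction l with
  | nil => simp only [List.nil_append, sz_nil]; omega
  | cons a l ih => simp only [List.cons_append, sz_cons]; omega

theorem sz_list (l : List α) : sz l = 1 + (l.map fun a => sz a + 1).sum := by
  induction l with
  | nil => rfl
  | cons a l ih => simp [ih]; omega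

@[simp] theorem sz_reverse (l : List α) : sz l.reverse = sz l := by
  simp [sz_list]

theorem length_lt_sz (l : List α) : l.length < sz l := by
  induction l with
  | nil => simp
  | cons a l ih => simp; omega

theorem sz_le_of_sublist {l m : List α} (h : l.Sublist m) : sz l ≤ sz m := by
  induction h with
  | slnil => rfl
  | cons a _ ih => simp; omega
  | cons_cons a _ ih => simp; omega

theorem sz_le_of_mem {l : List α} {a : α} (h : a ∈ l) : sz a < sz l := by
  induction l with
  | nil => simp at h
  | cons b l ih =>
    rcases List.mem_cons.1 h with rfl | h
    · simp only [sz_cons]; omega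
    · have := ih h; simp only [sz_cons]; omega

theorem sz_le_of_forall {l : List α} {k : ℕ} (h : ∀ a ∈ l, sz a ≤ k) :
    sz l ≤ l.length * (k + 1) + 1 := by
  induction l with
  | nil => simp
  | cons b l ih =>
    have h1 := ih fun a ha => h a (List.mem_cons_of_mem _ ha)
    have h2 := h b List.mem_cons_self
    simp only [sz_cons, List.length_cons]
    nlinarith

/-- The function is bounded by a polynomial in the size of its argument. -/
def PolyBdd (g : α → ℕ) : Prop := ∃ c, ∀ a, g a ≤ (sz a + 1) ^ c

namespace PolyBdd

variable {f g : α → ℕ}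

theorem mono (hg : PolyBdd g) (h : ∀ a, f a ≤ g a) : PolyBdd f :=
  let ⟨c, hc⟩ := hg
  ⟨c, fun a => (h a).trans (hc a)⟩

theorem const (k : ℕ) : PolyBdd fun _ : α => k :=
  -- The base `sz a + 1` is at least `2`, so the constant can serve as its own exponent.
  ⟨k, fun a => k.lt_two_pow_self.le.trans (Nat.pow_le_pow_left (by have := sz_pos a; omega) k)⟩

theorem size : PolyBdd fun a : α => sz a := ⟨1, fun a => by simp⟩

theorem add (hf : PolyBdd f) (hg : PolyBdd g) : PolyBdd fun a => f a + g a := by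
  obtain ⟨c, hc⟩ := hf
  obtain ⟨d, hd⟩ := hg
  refine ⟨c + d + 1, fun a => ?_⟩
  have h0 := sz_pos a
  have h1 : (sz a + 1) ^ c ≤ (sz a + 1) ^ (c + d) := Nat.pow_le_pow_right (by omega) (by omega)
  have h2 : (sz a + 1) ^ d ≤ (sz a + 1) ^ (c + d) := Nat.pow_le_pow_right (by omega) (by omega)
  rw [pow_succ]
  have := hc a
  have := hd a
  nlinarith

theorem mul (hf : PolyBdd f) (hg : PolyBdd g) : PolyBdd fun a => f a * g a := by
  obtain ⟨c, hc⟩ := hf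
  obtain ⟨d, hd⟩ := hg
  exact ⟨c + d, fun a => by rw [pow_add]; exact Nat.mul_le_mul (hc a) (hd a)⟩

theorem pow (hf : PolyBdd f) (k : ℕ) : PolyBdd fun a => f a ^ k := by
  induction k with
  | zero => simpa using const 1
  | succ k ih => simpa only [pow_succ] using ih.mul hf

theorem comp {g : β → ℕ} {f : α → β} (hg : PolyBdd g) (hf : PolyBdd fun a => sz (f a)) :
    PolyBdd fun a => g (f a) :=
  let ⟨c, hc⟩ := hg
  ((hf.add (const 1)).pow c).mono fun a => hc (f a)

end PolyBdd

/-! ### Functions computable in polynomial time -/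

/-- The function is computed by a program in polynomial time, and the size of its values is
polynomially bounded. -/
@[fun_prop]
def PolyTime (f : α → β) : Prop :=
  (∃ (p : Prog) (t : α → ℕ), PolyBdd t ∧ ∀ a, ∃ n ≤ t a, Runs p (enc a) (enc (f a)) n) ∧
    PolyBdd fun a => sz (f a)

namespace PolyTime

/-- The size bound does not follow from the time bound: `.pair .ident .ident` more than doubles a
tree in three steps, so values can be exponentially larger than the running time. Composition needs
both. -/
theorem size {f : α → β} (hf : PolyTime f) : PolyBdd fun a => sz (f a) := hf.2

theorem of_prog {f : α → β} (p : Prog) (k : ℕ) (h : ∀ a, ∃ n ≤ k, Runs p (enc a) (enc (f a)) n)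
    (hs : PolyBdd fun a => sz (f a)) : PolyTime f :=
  ⟨⟨p, fun _ => k, .const k, h⟩, hs⟩

@[fun_prop] theorem id : PolyTime fun a : α => a :=
  of_prog .ident 1 (fun _ => ⟨1, le_rfl, .ident _⟩) .size

@[fun_prop] theorem comp {g : β → γ} {f : α → β} (hg : PolyTime g) (hf : PolyTime f) :
    PolyTime fun a => g (f a) := by
  obtain ⟨⟨p, t, ht, hp⟩, hs⟩ := hf
  obtain ⟨⟨q, u, hu, hq⟩, hr⟩ := hg
  refine ⟨⟨.seq p q, fun a => t a + u (f a) + 1, (ht.add (hu.comp hs)).add (.const 1),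
    fun a => ?_⟩, hr.comp hs⟩
  obtain ⟨m, hm, h1⟩ := hp a
  obtain ⟨n, hn, h2⟩ := hq (f a)
  exact ⟨_, by dsimp only; omega, .seq h1 h2⟩

@[fun_prop] theorem pair {f : α → β} {g : α → γ} (hf : PolyTime f) (hg : PolyTime g) :
    PolyTime fun a => (f a, g a) := by
  obtain ⟨⟨p, t, ht, hp⟩, hs⟩ := hf
  obtain ⟨⟨q, u, hu, hq⟩, hr⟩ := hg
  refine ⟨⟨.pair p q, fun a => t a + u a + 1, (ht.add hu).add (.const 1), fun a => ?_⟩,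
    (hs.add hr).add (.const 1)⟩
  obtain ⟨m, hm, h1⟩ := hp a
  obtain ⟨n, hn, h2⟩ := hq a
  exact ⟨_, by dsimp only; omega, .pair h1 h2⟩

theorem fst' : PolyTime fun p : α × β => p.1 :=
  of_prog .fst 1 (fun _ => ⟨1, le_rfl, .fst_cons _ _⟩)
    (PolyBdd.size.mono fun p => by obtain ⟨a, b⟩ := p; simp only [sz_pair]; omega)

theorem snd' : PolyTime fun p : α × β => p.2 :=
  of_prog .snd 1 (fun _ => ⟨1, le_rfl, .snd_cons _ _⟩)
    (PolyBdd.size.mono fun p => by obtain ⟨a, b⟩ := p; simp only [sz_pair]; omega)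

@[fun_prop] theorem fst {f : α → β × γ} (hf : PolyTime f) : PolyTime fun a => (f a).1 :=
  fst'.comp hf

@[fun_prop] theorem snd {f : α → β × γ} (hf : PolyTime f) : PolyTime fun a => (f a).2 :=
  snd'.comp hf

theorem exists_constProg (y : Sexp) : ∃ (p : Prog) (k : ℕ), ∀ x, Runs p x y k := by
  induction y with
  | nil => exact ⟨.zero, 1, .zero⟩
  | cons y z ihy ihz =>
    obtain ⟨p, k, hp⟩ := ihy
    obtain ⟨q, l, hq⟩ := ihz
    exact ⟨.pair p q, k + l + 1, fun x => .pair (hp x) (hq x)⟩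

@[fun_prop] theorem const (b : β) : PolyTime fun _ : α => b := by
  obtain ⟨p, k, hp⟩ := exists_constProg (enc b)
  exact of_prog p k (fun a => ⟨k, le_rfl, hp _⟩) (.const _)

/-- Definition by cases on whether the list is empty. -/
theorem list_cases {l : α → List β} {f : α → γ} {g : α → β → List β → γ} (hl : PolyTime l)
    (hf : PolyTime f) (hg : PolyTime fun p : α × (β × List β) => g p.1 p.2.1 p.2.2) :
    PolyTime fun a => (match l a with
      | [] => f a
      | b :: m => g a b m) := by
  obtain ⟨⟨p, t, ht, hp⟩, hs⟩ := hl
  obtain ⟨⟨q, u, hu, hq⟩, hr⟩ := hf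
  obtain ⟨⟨r, v, ⟨c, hv⟩, hr'⟩, ⟨d, hd⟩⟩ := hg
  have hin : PolyBdd fun a => sz a + sz (l a) + 2 := (PolyBdd.size.add hs).add (.const 2)
  -- A non-empty list has the same tree as the pair of its head and tail, so the output of `p` can
  -- be handed to `r` unchanged.
  refine ⟨⟨.ite p (.seq (.pair .ident p) r) q,
    fun a => 2 * t a + u a + (sz a + sz (l a) + 2) ^ c + 4,
    ((((PolyBdd.const 2).mul ht).add hu).add (hin.pow c)).add (.const 4), fun a => ?_⟩,
    (hr.add (hin.pow d)).mono fun a => ?_⟩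
  · obtain ⟨m, hm, h1⟩ := hp a
    obtain ⟨n, hn, h2⟩ := hq a
    rcases hla : l a with _ | ⟨b, l'⟩ <;> simp only [hla]
    · rw [hla] at h1
      exact ⟨m + n + 1, by omega, .ite_false h1 h2⟩
    · rw [hla] at h1
      obtain ⟨k, hk, h3⟩ := hr' (a, b, l')
      have := hv (a, b, l')
      simp only [sz_pair, sz_cons] at this ⊢
      have e : sz a + (sz b + sz l' + 1) + 1 + 1 = sz a + (sz b + sz l' + 1) + 2 := by ring
      rw [e] at this
      exact ⟨m + (1 + m + 1 + k + 1) + 1, by omega, .ite_true h1 (.seq (.pair (.ident _) h1) h3)⟩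
  · rcases hla : l a with _ | ⟨b, l'⟩ <;> simp only [hla]
    · omega
    · have := hd (a, b, l')
      simp only [sz_pair, sz_cons] at this ⊢
      have e : sz a + (sz b + sz l' + 1) + 1 + 1 = sz a + (sz b + sz l' + 1) + 2 := by ring
      rw [e] at this
      omega

@[fun_prop] theorem list_cons {f : α → β} {g : α → List β} (hf : PolyTime f) (hg : PolyTime g) :
    PolyTime fun a => f a :: g a := by
  obtain ⟨⟨p, t, ht, hp⟩, hs⟩ := hf.pair hg
  exact ⟨⟨p, t, ht, hp⟩, hs⟩

@[fun_prop] theorem cond {c : α → Bool} {f g : α → β} (hc : PolyTime c) (hf : PolyTime f)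
    (hg : PolyTime g) : PolyTime fun a => bif c a then f a else g a := by
  obtain ⟨⟨p, t, ht, hp⟩, hs⟩ := hc
  obtain ⟨⟨q, u, hu, hq⟩, hr⟩ := hf
  obtain ⟨⟨r, v, hv, hr'⟩, hw⟩ := hg
  refine ⟨⟨.ite p q r, fun a => t a + u a + v a + 1, ((ht.add hu).add hv).add (.const 1),
    fun a => ?_⟩, (hr.add hw).mono fun a => ?_⟩
  · obtain ⟨m, hm, h1⟩ := hp a
    obtain ⟨n, hn, h2⟩ := hq a
    obtain ⟨k, hk, h3⟩ := hr' a
    cases hca : c a <;> rw [hca] at h1 <;> simp only [hca]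
    · exact ⟨m + k + 1, by omega, .ite_false h1 h3⟩
    · exact ⟨m + n + 1, by omega, .ite_true h1 h2⟩
  · change sz (bif c a then f a else g a) ≤ sz (f a) + sz (g a)
    cases c a
    · exact Nat.le_add_left _ _
    · exact Nat.le_add_right _ _

/-! ### Folds -/

/-- The program that folds a list with the step program `p`. -/
def foldProg (p : Prog) : Prog :=
  -- The state is `(a, l, s)`. As long as `l` is non-empty, it becomes `(a, tail, p (a, s, head))`.
  .loop (.seq .snd .fst) (.pair .fst (.pair (.seq .snd (.seq .fst .snd))
    (.seq (.pair .fst (.pair (.seq .snd .snd) (.seq .snd (.seq .fst .fst)))) p)))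

/-- The time bound `T` is demanded only at the states that the fold actually reaches; the cost of
`p` is not bounded uniformly over all states. The constants cover the pointer moves of a round. -/
theorem runs_foldProg {p : Prog} (a : α) {g : σ → β → σ} (l : List β) (s : σ) (T : ℕ)
    (h : ∀ l₁ x l₂, l = l₁ ++ x :: l₂ → ∃ n ≤ T,
      Runs p (enc (a, l₁.foldl g s, x)) (enc (g (l₁.foldl g s) x)) n) :
    ∃ n ≤ l.length * (T + 30) + 10, Runs (foldProg p) (enc (a, l, s))
      (enc (a, ([] : List β), l.foldl g s)) n := by
  induction l generalizing s with
  | nil =>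
    exact ⟨_, by simp, Runs.loop_stop (.seq (.snd_cons _ _) (.fst_cons _ _))⟩
  | cons x l ih =>
    obtain ⟨n, hn, h1⟩ := h [] x l rfl
    obtain ⟨k, hk, h2⟩ := ih (g s x) fun l₁ y l₂ e => by
      simpa using h (x :: l₁) y l₂ (by simp [e])
    have step := Runs.pair (.fst_cons (enc a) (enc (x :: l, s)))
      (.pair (.seq (.snd_cons (enc a) (enc (x :: l, s)))
        (.seq (.fst_cons (enc (x :: l)) (enc s)) (.snd_cons (enc x) (enc l))))
        (.seq (.pair (.fst_cons (enc a) (enc (x :: l, s)))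
          (.pair (.seq (.snd_cons (enc a) (enc (x :: l, s))) (.snd_cons (enc (x :: l)) (enc s)))
            (.seq (.snd_cons (enc a) (enc (x :: l, s)))
              (.seq (.fst_cons (enc (x :: l)) (enc s)) (.fst_cons (enc x) (enc l)))))) h1))
    refine ⟨_, ?_, .loop_step (.seq (.snd_cons _ _) (.fst_cons _ _)) step h2⟩
    simp only [List.length_cons]
    have : (l.length + 1) * (T + 30) = l.length * (T + 30) + T + 30 := by ring
    omega

/-- A polynomial-time step does not suffice, because repeated doubling makes the state exponentially
large. The bound `D` on all intermediate states excludes this and makes every round polynomial. -/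
theorem foldl {l : α → List β} {s : α → σ} {g : α → σ → β → σ} (hl : PolyTime l) (hs : PolyTime s)
    (hg : PolyTime fun p : α × (σ × β) => g p.1 p.2.1 p.2.2) {D : α → ℕ} (hD : PolyBdd D)
    (h : ∀ a, ∀ l', l' <+: l a → sz (l'.foldl (g a) (s a)) ≤ D a) :
    PolyTime fun a => (l a).foldl (g a) (s a) := by
  obtain ⟨⟨p, t, ht, hp⟩, hlz⟩ := hl
  obtain ⟨⟨q, u, hu, hq⟩, hsz⟩ := hs
  obtain ⟨⟨r, v, ⟨c, hv⟩, hr⟩, -⟩ := hg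
  have hT : PolyBdd fun a => (sz a + D a + sz (l a) + 3) ^ c :=
    (((PolyBdd.size.add hD).add hlz).add (.const 3)).pow c
  refine ⟨⟨.seq (.pair .ident (.pair p q)) (.seq (foldProg r) (.seq .snd .snd)),
    fun a => t a + u a + sz (l a) * ((sz a + D a + sz (l a) + 3) ^ c + 30) + 30,
    ((ht.add hu).add (hlz.mul (hT.add (.const 30)))).add (.const 30), fun a => ?_⟩,
    hD.mono fun a => h a _ (List.prefix_refl _)⟩
  obtain ⟨m, hm, h1⟩ := hp a
  obtain ⟨n, hn, h2⟩ := hq a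
  obtain ⟨k, hk, h3⟩ := runs_foldProg (p := r) a (g := g a) (l a) (s a)
    ((sz a + D a + sz (l a) + 3) ^ c) fun l₁ x l₂ e => by
      obtain ⟨n, hn, h1⟩ := hr (a, l₁.foldl (g a) (s a), x)
      refine ⟨n, hn.trans ((hv _).trans (Nat.pow_le_pow_left ?_ c)), h1⟩
      have h4 := h a l₁ (e ▸ List.prefix_append _ _)
      have h5 : sz x < sz (l a) := sz_le_of_mem (by simp [e])
      simp only [sz_pair]
      omega
  refine ⟨_, ?_, .seq (.pair (.ident _) (.pair h1 h2))
    (.seq h3 (.seq (.snd_cons _ _) (.snd_cons _ _)))⟩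
  have : (l a).length * ((sz a + D a + sz (l a) + 3) ^ c + 30) ≤
    sz (l a) * ((sz a + D a + sz (l a) + 3) ^ c + 30) :=
    Nat.mul_le_mul_right _ (length_lt_sz _).le
  dsimp only
  omega

end PolyTime

/-! ### List and Boolean operations in polynomial time -/

namespace PolyTime

theorem reverse' : PolyTime fun l : List α => l.reverse := by
  have h : PolyTime fun l : List α => l.foldl (fun m a => a :: m) [] :=
    foldl (D := sz) (.id) (.const _) (by fun_prop) .size fun l l' h => by
      have : l'.foldl (fun m a => a :: m) [] = l'.reverse := by
        simp
      rw [this, sz_reverse]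
      exact sz_le_of_sublist h.sublist
  simpa using h

@[fun_prop] theorem reverse {l : α → List β} (hl : PolyTime l) :
    PolyTime fun a => (l a).reverse := reverse'.comp hl

theorem foldr {l : α → List β} {s : α → σ} {g : α → β → σ → σ} (hl : PolyTime l) (hs : PolyTime s)
    (hg : PolyTime fun p : α × (β × σ) => g p.1 p.2.1 p.2.2) {D : α → ℕ} (hD : PolyBdd D)
    (h : ∀ a, ∀ l', l' <:+ l a → sz (l'.foldr (g a) (s a)) ≤ D a) :
    PolyTime fun a => (l a).foldr (g a) (s a) := by
  have : PolyTime fun a => (l a).reverse.foldl (fun t x => g a x t) (s a) :=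
    foldl hl.reverse hs (g := fun a t x => g a x t)
      (hg.comp (f := fun p : α × (σ × β) => (p.1, p.2.2, p.2.1)) (by fun_prop)) hD
      fun a l' h' => by
        rw [← List.foldr_reverse]
        exact h a _ (by rwa [← List.reverse_prefix, List.reverse_reverse])
  simpa using this

@[fun_prop] theorem append {l m : α → List β} (hl : PolyTime l) (hm : PolyTime m) :
    PolyTime fun a => l a ++ m a := by
  have : PolyTime fun a => (l a).foldr (fun x s => x :: s) (m a) :=
    foldr (g := fun _ x s => x :: s) hl hm (by fun_prop) (hl.size.add hm.size) fun a l' h => by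
      have h1 := sz_le_of_sublist h.sublist
      have h2 := sz_append l' (m a)
      have : l'.foldr (fun x s => x :: s) (m a) = l' ++ m a := by simp
      rw [this]
      omega
  simpa using this

theorem foldr_append {β γ : Type} (f : β → List γ) (l : List β) :
    l.foldr (fun x s => f x ++ s) [] = l.flatMap f := by
  induction l with
  | nil => rfl
  | cons x l ih => rw [List.foldr_cons, ih, List.flatMap_cons]

theorem flatMap {l : α → List β} {f : α → β → List γ} (hl : PolyTime l)
    (hf : PolyTime fun p : α × β => f p.1 p.2) : PolyTime fun a => (l a).flatMap (f a) := by
  obtain ⟨c, hc⟩ := hf.size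
  have key : ∀ a (l' : List β), sz (l'.flatMap (f a)) ≤ l'.length * (sz a + sz l' + 2) ^ c + 1 := by
    intro a l'
    induction l' with
    | nil => simp
    | cons x l' ih =>
      have h1 := sz_append (f a x) (l'.flatMap (f a))
      have h2 : sz (f a x) ≤ (sz a + sz (x :: l') + 2) ^ c :=
        (hc (a, x)).trans (Nat.pow_le_pow_left (by simp; omega) c)
      have h3 : l'.length * (sz a + sz l' + 2) ^ c ≤ l'.length * (sz a + sz (x :: l') + 2) ^ c :=
        Nat.mul_le_mul_left _ (Nat.pow_le_pow_left (by simp; omega) c)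
      simp only [List.flatMap_cons, List.length_cons]
      rw [add_one_mul]
      omega
  have : PolyTime fun a => (l a).foldr (fun x s => f a x ++ s) [] :=
    foldr (g := fun a x s => f a x ++ s) hl (.const _)
      (append (hf.comp (f := fun p : α × (β × List γ) => (p.1, p.2.1)) (by fun_prop)) (by fun_prop))
      (D := fun a => sz (l a) * (sz a + sz (l a) + 2) ^ c + 1)
      ((hl.size.mul (((PolyBdd.size.add hl.size).add (.const 2)).pow c)).add (.const 1))
      fun a l' h => by
        have h1 := sz_le_of_sublist h.sublist
        have h2 := key a l'
        have h3 := length_lt_sz l'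
        rw [foldr_append]
        refine h2.trans (Nat.add_le_add_right (Nat.mul_le_mul (by omega)
          (Nat.pow_le_pow_left (by omega) c)) 1)
  simpa only [foldr_append] using this

theorem map {l : α → List β} {f : α → β → γ} (hl : PolyTime l)
    (hf : PolyTime fun p : α × β => f p.1 p.2) : PolyTime fun a => (l a).map (f a) := by
  have := flatMap (f := fun a x => [f a x]) hl (by fun_prop)
  simpa only [List.flatMap_pure_eq_map, ← List.map_eq_flatMap] using this

theorem filter {l : α → List β} {f : α → β → Bool} (hl : PolyTime l)
    (hf : PolyTime fun p : α × β => f p.1 p.2) : PolyTime fun a => (l a).filter (f a) := by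
  have := flatMap (f := fun a x => bif f a x then [x] else []) hl (by fun_prop)
  have e : ∀ a, (l a).flatMap (fun x => bif f a x then [x] else []) = (l a).filter (f a) := by
    intro a
    induction l a with
    | nil => rfl
    | cons x l' ih => cases h : f a x <;> simp [List.flatMap_cons, ih, h]
  simpa only [e] using this

@[fun_prop] theorem and {f g : α → Bool} (hf : PolyTime f) (hg : PolyTime g) :
    PolyTime fun a => f a && g a := by
  have := hf.cond hg (.const false)
  simpa only [Bool.cond_false_right] using this

@[fun_prop] theorem or {f g : α → Bool} (hf : PolyTime f) (hg : PolyTime g) :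
    PolyTime fun a => f a || g a := by
  have := hf.cond (.const true) hg
  simpa only [Bool.cond_true_left] using this

@[fun_prop] theorem not {f : α → Bool} (hf : PolyTime f) : PolyTime fun a => !f a := by
  have := hf.cond (.const false) (.const true)
  simpa only [Bool.cond_false_left, Bool.and_true] using this

theorem isEmpty {l : α → List β} (hl : PolyTime l) : PolyTime fun a => (l a).isEmpty := by
  have := list_cases (g := fun _ _ _ => false) hl (.const true) (.const false)
  exact this

theorem all {l : α → List β} {f : α → β → Bool} (hl : PolyTime l)
    (hf : PolyTime fun p : α × β => f p.1 p.2) : PolyTime fun a => (l a).all (f a) := by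
  have := isEmpty (filter (f := fun a x => !f a x) hl (by fun_prop))
  have e : ∀ a, ((l a).filter fun x => !f a x).isEmpty = (l a).all (f a) := by
    intro a
    induction l a with
    | nil => rfl
    | cons x l' ih => cases h : f a x <;> simp [ih, h]
  simpa only [e] using this

theorem any {l : α → List β} {f : α → β → Bool} (hl : PolyTime l)
    (hf : PolyTime fun p : α × β => f p.1 p.2) : PolyTime fun a => (l a).any (f a) := by
  have := (all (f := fun a x => !f a x) hl (by fun_prop)).not
  simpa only [List.not_all_eq_any_not, Bool.not_not] using this

/-! ### Natural numbers -/

/-- A unary number and a list of units are the same tree, so folds over lists also give bounded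
iteration and arithmetic. -/
theorem enc_replicate (n : ℕ) : enc (List.replicate n ()) = enc n := by
  induction n with
  | zero => rfl
  | succ n ih => simp [List.replicate_succ, ih]

@[fun_prop] theorem replicate {n : α → ℕ} (hn : PolyTime n) :
    PolyTime fun a => List.replicate (n a) () := by
  obtain ⟨⟨p, t, ht, h⟩, hs⟩ := hn
  refine ⟨⟨p, t, ht, fun a => by rw [enc_replicate]; exact h a⟩, hs.mono fun a => ?_⟩
  rw [sz, enc_replicate]
  exact le_rfl

@[fun_prop] theorem succ {n : α → ℕ} (hn : PolyTime n) : PolyTime fun a => n a + 1 := by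
  obtain ⟨⟨p, t, ht, h⟩, hs⟩ := (PolyTime.const ()).pair hn
  exact ⟨⟨p, t, ht, h⟩, hs⟩

theorem iterate {n : α → ℕ} {s : α → σ} {g : α → σ → σ} (hn : PolyTime n) (hs : PolyTime s)
    (hg : PolyTime fun p : α × σ => g p.1 p.2) {D : α → ℕ} (hD : PolyBdd D)
    (h : ∀ a, ∀ m ≤ n a, sz ((g a)^[m] (s a)) ≤ D a) : PolyTime fun a => (g a)^[n a] (s a) := by
  have e : ∀ a (l : List Unit), l.foldl (fun s _ => g a s) (s a) = (g a)^[l.length] (s a) := by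
    intro a l
    induction l using List.reverseRecOn with
    | nil => rfl
    | append_singleton l x ih => simp [ih, Function.iterate_succ_apply']
  have := foldl (g := fun a s (_ : Unit) => g a s) hn.replicate hs
    (hg.comp (f := fun p : α × (σ × Unit) => (p.1, p.2.1)) (by fun_prop)) hD fun a l' hl => by
      rw [e]
      exact h a _ (by simpa using hl.length_le)
  simpa only [e, List.length_replicate] using this

theorem pred' : PolyTime fun n : ℕ => n - 1 :=
  of_prog .snd 1 (fun n => ⟨1, le_rfl, by cases n; exacts [.snd_nil, .snd_cons _ _]⟩)
    (PolyBdd.size.mono fun n => by simp)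

@[fun_prop] theorem add {m n : α → ℕ} (hm : PolyTime m) (hn : PolyTime n) :
    PolyTime fun a => m a + n a := by
  have e : ∀ m k, (fun k => k + 1)^[k] m = m + k := Nat.succ_iterate
  have := iterate (g := fun _ k => k + 1) hn hm (by fun_prop) (hm.size.add hn.size) fun a k hk => by
    rw [e]; simp; omega
  simpa only [e] using this

@[fun_prop] theorem sub {m n : α → ℕ} (hm : PolyTime m) (hn : PolyTime n) :
    PolyTime fun a => m a - n a := by
  have e : ∀ m k, (fun k => k - 1)^[k] m = m - k := Nat.pred_iterate
  have := iterate (g := fun _ k => k - 1) hn hm (pred'.comp (by fun_prop)) hm.size fun a k hk => by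
    rw [e]; simp
  simpa only [e] using this

@[fun_prop] theorem mul {m n : α → ℕ} (hm : PolyTime m) (hn : PolyTime n) :
    PolyTime fun a => m a * n a := by
  have e : ∀ a k, (fun s => s + m a)^[k] 0 = m a * k := by
    intro a k
    induction k with
    | zero => rfl
    | succ k ih => rw [Function.iterate_succ_apply', ih]; ring
  have := iterate (g := fun a k => k + m a) hn (.const 0)
    (add .snd' (hm.comp .fst')) (hm.size.mul hn.size) fun a k hk => by
      rw [e]; simp; nlinarith [Nat.mul_le_mul_left (m a) hk]
  simpa only [e] using this

theorem pow {m : α → ℕ} (hm : PolyTime m) (r : ℕ) : PolyTime fun a => m a ^ r := by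
  induction r with
  | zero => simpa using PolyTime.const 1
  | succ r ih => simpa only [pow_succ] using ih.mul hm

theorem isZero {n : α → ℕ} (hn : PolyTime n) : PolyTime fun a => decide (n a = 0) := by
  have := isEmpty hn.replicate
  have e : ∀ n, (List.replicate n ()).isEmpty = decide (n = 0) := fun n => by cases n <;> rfl
  simpa only [e] using this

@[fun_prop] theorem decide_le {m n : α → ℕ} (hm : PolyTime m) (hn : PolyTime n) :
    PolyTime fun a => decide (m a ≤ n a) := by
  simpa only [Nat.sub_eq_zero_iff_le] using isZero (hm.sub hn)

@[fun_prop] theorem decide_eq {m n : α → ℕ} (hm : PolyTime m) (hn : PolyTime n) :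
    PolyTime fun a => decide (m a = n a) := by
  have := (hm.decide_le hn).and (hn.decide_le hm)
  simpa only [le_antisymm_iff, Bool.decide_and] using this

@[fun_prop] theorem mod {m n : α → ℕ} (hm : PolyTime m) (hn : PolyTime n) :
    PolyTime fun a => m a % n a := by
  -- The remainder is a counter that wraps around at `n a`. For `n a = 0` it never wraps, in
  -- accordance with `k % 0 = k`.
  have e : ∀ a k, (fun s => bif decide (s + 1 = n a) then 0 else s + 1)^[k] 0 = k % n a := by
    intro a k
    induction k with
    | zero => simp
    | succ k ih =>
      rw [Function.iterate_succ_apply', ih]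
      by_cases h : k % n a + 1 = n a
      · rw [decide_eq_true h, cond_true, Nat.add_mod]
        rcases Nat.lt_or_ge 1 (n a) with h1 | h1
        · rw [Nat.mod_eq_of_lt h1, h, Nat.mod_self]
        · rw [show n a = 1 by omega, Nat.mod_one]
      · rw [decide_eq_false h, cond_false]
        rcases Nat.eq_zero_or_pos (n a) with h0 | h0
        · simp [h0]
        · have := Nat.mod_lt k h0
          rw [← Nat.mod_add_mod, Nat.mod_eq_of_lt (a := k % n a + 1) (by omega)]
  have hn' : PolyTime fun p : α × ℕ => n p.1 := hn.comp .fst'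
  have := iterate (g := fun a s => bif decide (s + 1 = n a) then 0 else s + 1) hm (.const 0)
    (by fun_prop) hm.size fun a k hk => by
      have := Nat.mod_le k (n a)
      rw [e]; simp; omega
  simpa only [e] using this

@[fun_prop] theorem length {l : α → List β} (hl : PolyTime l) : PolyTime fun a => (l a).length := by
  have e : ∀ l : List β, l.foldl (fun n _ => n + 1) 0 = l.length := fun l => by
    induction l using List.reverseRecOn with
    | nil => rfl
    | append_singleton l x ih => simp [ih]
  have := foldl (g := fun _ n _ => n + 1) hl (.const 0) (by fun_prop)
    ((PolyBdd.const 2).mul hl.size) fun a l' h => by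
      have h1 := length_lt_sz (l a)
      have h2 := h.length_le
      rw [e]; simp; omega
  simpa only [e] using this

@[fun_prop] theorem range {n : α → ℕ} (hn : PolyTime n) : PolyTime fun a => List.range (n a) := by
  have e : ∀ k, (fun l : List ℕ => l ++ [l.length])^[k] [] = List.range k := fun k => by
    induction k with
    | zero => rfl
    | succ k ih => rw [Function.iterate_succ_apply', ih, List.length_range, List.range_succ]
  have := iterate (g := fun _ (l : List ℕ) => l ++ [l.length]) hn (.const []) (by fun_prop)
    (D := fun a => sz (n a) * (sz (n a) + 1) + 1)
    ((hn.size.mul (hn.size.add (.const 1))).add (.const 1)) fun a k hk => by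
      rw [e]
      refine (sz_le_of_forall (k := sz (n a)) fun x hx => ?_).trans ?_
      · have := List.mem_range.1 hx
        simp; omega
      · exact Nat.add_le_add_right (Nat.mul_le_mul_right _ (by simp; omega)) 1
  simpa only [e] using this

/-! ### Further list operations -/

@[fun_prop] theorem flatten {l : α → List (List β)} (hl : PolyTime l) :
    PolyTime fun a => (l a).flatten := by
  have := flatMap (f := fun _ x => x) hl (by fun_prop)
  simpa only [List.flatMap_id'] using this

@[fun_prop] theorem zip {l : α → List β} {m : α → List γ} (hl : PolyTime l) (hm : PolyTime m) :
    PolyTime fun a => (l a).zip (m a) := by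
  -- The state holds the pairs made so far and the unused rest of the second list.
  let g : List (β × γ) × List γ → β → List (β × γ) × List γ := fun s x =>
    match s.2 with
    | [] => (s.1, [])
    | y :: r => (s.1 ++ [(x, y)], r)
  have e : ∀ (l : List β) (k : List (β × γ)) (m : List γ),
      l.foldl g (k, m) = (k ++ l.zip m, m.drop l.length) := by
    intro l
    induction l with
    | nil => simp
    | cons x l ih =>
      intro k m
      cases m with
      | nil => simp [g, ih]
      | cons y m => simp [g, ih]
  have hg : PolyTime fun p : α × ((List (β × γ) × List γ) × β) => g p.2.1 p.2.2 :=
    list_cases (l := fun p : α × ((List (β × γ) × List γ) × β) => p.2.1.2)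
      (f := fun p => (p.2.1.1, [])) (g := fun p y r => (p.2.1.1 ++ [(p.2.2, y)], r))
      (by fun_prop) (by fun_prop) (by fun_prop)
  have hz : ∀ (l : List β) (m : List γ), sz (l.zip m) ≤ sz l + sz m := by
    intro l
    induction l with
    | nil => simp
    | cons x l ih =>
      intro m
      cases m with
      | nil => simp
      | cons y m => have := ih m; simp only [List.zip_cons_cons, sz_cons, sz_pair]; omega
  have := (foldl (g := fun _ => g) hl ((PolyTime.const []).pair hm) hg
    (D := fun a => sz (l a) + 2 * sz (m a) + 1)
    ((hl.size.add ((PolyBdd.const 2).mul hm.size)).add (.const 1)) fun a l' h => by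
      have h1 := hz l' (m a)
      have h2 := sz_le_of_sublist h.sublist
      have h3 := sz_le_of_sublist (List.drop_sublist l'.length (m a))
      rw [e, sz_pair, List.nil_append]
      omega).fst
  simpa only [e, List.nil_append] using this

end PolyTime

/-! ### The algorithm -/

/-- Finite partial maps from numbers to numbers, as lists of argument-value pairs. -/
abbrev PMap := List (ℕ × ℕ)

/-- The partial maps have the same value wherever both are defined. -/
def agree (f g : PMap) : Bool :=
  f.all fun p => g.all fun r => !decide (p.1 = r.1) || decide (p.2 = r.2)

/-- Extend all the partial maps of a list by a value at `v`, unless the list is too long. -/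
def extend (M : ℕ) (dom : List ℕ) (ok : PMap → Bool) (v : ℕ) (L : List PMap) : List PMap :=
  bif decide (L.length ≤ M) then (L.flatMap fun f => dom.map fun b => (v, b) :: f).filter ok else L

/-- The list of partial maps from `vs` to `dom` that satisfy `ok`, provided that the list never
gets too long. -/
def build (M : ℕ) (dom : List ℕ) (ok : PMap → Bool) (vs : List ℕ) : List PMap :=
  vs.foldr (extend M dom ok) ([[]].filter ok)

/-- Delete the maps that agree with no map in one of the lists. -/
def consRound (F : List (List PMap)) : List (List PMap) :=
  F.map fun R => R.filter fun f => F.all fun S => S.any fun g => agree f g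

/-- Repeat `consRound` until nothing changes. -/
def consFix (F : List (List PMap)) : List (List PMap) :=
  -- Each round that changes something deletes a map, so the number of maps bounds the number of
  -- useful rounds.
  consRound^[F.flatten.length] F

/-- The lists of partial maps on the ranges of the given words, unless they are too long. -/
def candidates (M kA kB : ℕ) (ok : PMap → Bool) (words : List PMap) : List (List PMap) :=
  -- A word stands for the set of its letters below `kA`; the additional letter `kA` is ignored.
  (words.map fun w => build M (List.range kB) ok
    ((List.range kA).filter fun v => w.any fun r => decide (r.2 = v))).filter
      fun L => decide (L.length ≤ M)

/-- The consistency test. -/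
def solvable (M kA kB : ℕ) (ok : PMap → Bool) (words : List PMap) : Bool :=
  (consFix (candidates M kA kB ok words)).all fun R => !R.isEmpty

/-- Every tuple can be mapped to a tuple of the corresponding relation, as far as the partial map
is concerned. -/
def tupleOk (cs : List (List ℕ × List (List ℕ))) (f : PMap) : Bool :=
  cs.all fun t => t.2.any fun u => agree (t.1.zip u) f

/-- A hash function with values below `q`. -/
def hash (q m a b : ℕ) : ℕ := (a * b) % m % q

/-- The colouring `c` of the hash values is a left inverse of the partial map. -/
def colorOk (q m a : ℕ) (c f : PMap) : Bool :=
  agree (f.map fun p => (hash q m a p.2, p.1)) c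

/-- All tuples of the relations of the first structure, with the corresponding relations of the
second one. -/
def constraints (RA RB : List (List (List ℕ))) : List (List ℕ × List (List ℕ)) :=
  (RA.zip RB).flatMap fun p => p.1.map fun t => (t, p.2)

/-- A representation of a structure by its number of elements and its relations. -/
abbrev StructCode := ℕ × List (List (List ℕ))

/-- The number of hash values. -/
def hashSize (k : ℕ) : ℕ := 2 * ((k + 1) * (k + 1))

/-- All words over the elements of the first structure and one more letter. -/
def allWords (pad k : ℕ) : List PMap :=
  build pad (List.range (k + 1)) (fun _ => true) (List.range (hashSize k))

/-- The embedding test; `pad` has to be large enough. -/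
def solve (r pad : ℕ) (A B : StructCode) : Bool :=
  -- The range contains a prime above `B.1`, by Bertrand's postulate, and all multipliers below that
  -- prime.
  (List.range (2 * B.1 + 3)).any fun m => (List.range (2 * B.1 + 3)).any fun a =>
    (allWords pad A.1).any fun c =>
      -- The cap is the fractional edge cover bound: `B.2.flatten.length` is the total number of
      -- tuples of the target. The same words serve as colourings `c` and as names of subsets.
      solvable ((B.2.flatten.length + 1) ^ r) A.1 B.1
        (fun f => tupleOk (constraints A.2 B.2) f && colorOk (hashSize A.1) m a c f)
        (allWords pad A.1)

/-! ### The algorithm runs in polynomial time -/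

namespace PolyTime

@[fun_prop] theorem agree {f g : α → PMap} (hf : PolyTime f) (hg : PolyTime g) :
    PolyTime fun a => agree (f a) (g a) :=
  all hf (all (f := fun (p : α × (ℕ × ℕ)) r => !decide (p.2.1 = r.1) || decide (p.2.2 = r.2))
    (hg.comp .fst') (by fun_prop))

/-- A list longer than `M` is not extended any more, so lists overshoot the cap by at most one
factor `dom.length`. This keeps `build` polynomial although there may be exponentially many partial
maps. The summand `1` accounts for the initial list. -/
theorem length_build_and_sz_le (M : ℕ) (dom : List ℕ) (ok : PMap → Bool) (vs : List ℕ) :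
    (build M dom ok vs).length ≤ M * dom.length + 1 ∧
      ∀ f ∈ build M dom ok vs, sz f ≤ vs.length * (sz vs + sz dom + 2) + 1 := by
  induction vs with
  | nil =>
    constructor
    · exact (List.length_filter_le _ _).trans (by simp)
    · intro f hf
      have := List.mem_of_mem_filter hf
      simp only [List.mem_singleton] at this
      simp [this]
  | cons v vs ih =>
    have mono : vs.length * (sz vs + sz dom + 2) + (sz (v :: vs) + sz dom + 2) ≤
        (v :: vs).length * (sz (v :: vs) + sz dom + 2) := by
      rw [List.length_cons, add_one_mul]
      exact Nat.add_le_add_right (Nat.mul_le_mul_left _ (by simp only [sz_cons]; omega)) _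
    change (extend M dom ok v (build M dom ok vs)).length ≤ _ ∧
      ∀ f ∈ extend M dom ok v (build M dom ok vs), _
    unfold extend
    by_cases h : (build M dom ok vs).length ≤ M
    · rw [decide_eq_true h, cond_true]
      constructor
      · refine (List.length_filter_le _ _).trans ?_
        rw [List.length_flatMap]
        simp only [List.length_map, List.map_const', List.sum_replicate, smul_eq_mul]
        exact (Nat.mul_le_mul_right _ h).trans (Nat.le_succ _)
      · intro f hf
        obtain ⟨g, hg, hf⟩ := List.mem_flatMap.1 (List.mem_of_mem_filter hf)
        obtain ⟨b, hb, rfl⟩ := List.mem_map.1 hf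
        have h1 := ih.2 g hg
        have h2 := sz_le_of_mem hb
        simp only [sz_cons, sz_pair] at *
        omega
    · rw [decide_eq_false h, cond_false]
      exact ⟨ih.1, fun f hf => (ih.2 f hf).trans (by omega)⟩

theorem build {M : α → ℕ} {dom vs : α → List ℕ} {ok : α → PMap → Bool} (hM : PolyTime M)
    (hdom : PolyTime dom) (hok : PolyTime fun p : α × PMap => ok p.1 p.2) (hvs : PolyTime vs) :
    PolyTime fun a => build (M a) (dom a) (ok a) (vs a) := by
  refine foldr (g := fun a => extend (M a) (dom a) (ok a)) hvs
    (filter (f := ok) (.const [[]]) hok) ?_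
    (D := fun a => (sz (M a) * sz (dom a) + 1) *
      (sz (vs a) * (sz (vs a) + sz (dom a) + 2) + 2) + 1)
    ((((hM.size.mul hdom.size).add (.const 1)).mul ((hvs.size.mul
      ((hvs.size.add hdom.size).add (.const 2))).add (.const 2))).add (.const 1)) fun a l' h => ?_
  · refine cond ((length ?_).decide_le (hM.comp .fst')) ?_ ?_
    · fun_prop
    · refine filter (f := fun (p : α × (ℕ × List PMap)) f => ok p.1 f)
        (flatMap (f := fun (p : α × (ℕ × List PMap)) f => (dom p.1).map fun b => (p.2.1, b) :: f)
          (by fun_prop) ?_) (hok.comp (f := fun p : (α × (ℕ × List PMap)) × PMap => (p.1.1, p.2))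
            (by fun_prop))
      exact map (f := fun (p : (α × (ℕ × List PMap)) × PMap) b => (p.1.2.1, b) :: p.2)
        (hdom.comp (by fun_prop)) (by fun_prop)
    · fun_prop
  · obtain ⟨h1, h2⟩ := length_build_and_sz_le (M a) (dom a) (ok a) l'
    have h3 := sz_le_of_sublist h.sublist
    have h4 := length_lt_sz l'
    have h5 := length_lt_sz (dom a)
    refine (sz_le_of_forall h2).trans (Nat.add_le_add_right (Nat.mul_le_mul (h1.trans ?_) ?_) 1)
    · exact Nat.add_le_add_right (Nat.mul_le_mul (by simp; omega) h5.le) 1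
    · exact Nat.add_le_add_right (Nat.add_le_add_right
        (Nat.mul_le_mul (by omega) (by omega)) 1) 1

theorem sz_consRound_le (F : List (List PMap)) : sz (consRound F) ≤ sz F := by
  unfold consRound
  generalize (fun f => F.all fun S => S.any fun g => EmbFPT.agree f g) = P
  induction F with
  | nil => simp
  | cons R F ih =>
    have := sz_le_of_sublist (List.filter_sublist (p := P) (l := R))
    simp only [List.map_cons, sz_cons]
    omega

theorem consRound' : PolyTime consRound := by
  refine map (f := fun (F : List (List PMap)) (R : List PMap) =>
      R.filter fun f => F.all fun S => S.any fun g => EmbFPT.agree f g) .id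
    (filter (f := fun (p : List (List PMap) × List PMap) f =>
      p.1.all fun S => S.any fun g => EmbFPT.agree f g) .snd' (all (f :=
        fun (p : (List (List PMap) × List PMap) × PMap) (S : List PMap) =>
          S.any fun g => EmbFPT.agree p.2 g)
        (by fun_prop) (any (f := fun (p : ((List (List PMap) × List PMap) × PMap) × List PMap) g =>
          EmbFPT.agree p.1.2 g) (by fun_prop) (by fun_prop))))

theorem consFix {F : α → List (List PMap)} (hF : PolyTime F) : PolyTime fun a => consFix (F a) := by
  refine iterate (g := fun _ => consRound) (by fun_prop) hF (consRound'.comp .snd') hF.size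
    fun a m hm => ?_
  clear hm
  induction m with
  | zero => exact le_rfl
  | succ m ih => rw [Function.iterate_succ_apply']; exact (sz_consRound_le _).trans ih

theorem candidates {M kA kB : α → ℕ} {ok : α → PMap → Bool} {words : α → List PMap}
    (hM : PolyTime M) (hA : PolyTime kA) (hB : PolyTime kB)
    (hok : PolyTime fun p : α × PMap => ok p.1 p.2) (hw : PolyTime words) :
    PolyTime fun a => candidates (M a) (kA a) (kB a) (ok a) (words a) := by
  refine filter (f := fun a L => decide (L.length ≤ M a)) (map (f := fun a w =>
    EmbFPT.build (M a) (List.range (kB a)) (ok a)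
      ((List.range (kA a)).filter fun v => w.any fun r => decide (r.2 = v))) hw
    (build (ok := fun p => ok p.1) (hM.comp .fst') (range (hB.comp .fst'))
      (hok.comp (f := fun p : (α × PMap) × PMap => (p.1.1, p.2)) (by fun_prop)) ?_)) ?_
  · exact filter (f := fun (p : α × PMap) (v : ℕ) => p.2.any fun r => decide (r.2 = v))
      (range (hA.comp .fst')) (any (f := fun (p : (α × PMap) × ℕ) (r : ℕ × ℕ) => decide (r.2 = p.2))
        (by fun_prop) (by fun_prop))
  · exact (length .snd').decide_le (hM.comp .fst')

theorem solvable {M kA kB : α → ℕ} {ok : α → PMap → Bool} {words : α → List PMap}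
    (hM : PolyTime M) (hA : PolyTime kA) (hB : PolyTime kB)
    (hok : PolyTime fun p : α × PMap => ok p.1 p.2) (hw : PolyTime words) :
    PolyTime fun a => solvable (M a) (kA a) (kB a) (ok a) (words a) :=
  all (f := fun _ (R : List PMap) => !R.isEmpty) (consFix (candidates hM hA hB hok hw))
    (not (isEmpty .snd'))

theorem tupleOk {cs : α → List (List ℕ × List (List ℕ))} {f : α → PMap} (hcs : PolyTime cs)
    (hf : PolyTime f) : PolyTime fun a => tupleOk (cs a) (f a) :=
  all (f := fun a (t : List ℕ × List (List ℕ)) => t.2.any fun u => EmbFPT.agree (t.1.zip u) (f a)) hcs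
    (any (f := fun (p : α × (List ℕ × List (List ℕ))) (u : List ℕ) => EmbFPT.agree (p.2.1.zip u) (f p.1))
      (by fun_prop) (agree (zip (by fun_prop) (by fun_prop)) (hf.comp (by fun_prop))))

theorem colorOk {q m n : α → ℕ} {c f : α → PMap} (hq : PolyTime q) (hm : PolyTime m)
    (hn : PolyTime n) (hc : PolyTime c) (hf : PolyTime f) :
    PolyTime fun a => colorOk (q a) (m a) (n a) (c a) (f a) := by
  refine agree (map (f := fun a p => (hash (q a) (m a) (n a) p.2, p.1)) hf (pair ?_ ?_)) hc
  · exact ((mul (hn.comp .fst') (by fun_prop)).mod (hm.comp .fst')).mod (hq.comp .fst')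
  · fun_prop

theorem constraints {RA RB : α → List (List (List ℕ))} (hA : PolyTime RA) (hB : PolyTime RB) :
    PolyTime fun a => constraints (RA a) (RB a) :=
  flatMap (f := fun _ (p : List (List ℕ) × List (List ℕ)) => p.1.map fun t => (t, p.2)) (by fun_prop)
    (map (f := fun (p : α × (List (List ℕ) × List (List ℕ))) (t : List ℕ) => (t, p.2.2)) (by fun_prop)
      (by fun_prop))

@[fun_prop] theorem hashSize {k : α → ℕ} (hk : PolyTime k) : PolyTime fun a => hashSize (k a) := by
  unfold EmbFPT.hashSize
  fun_prop

@[fun_prop] theorem allWords {m k : α → ℕ} (hm : PolyTime m) (hk : PolyTime k) :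
    PolyTime fun a => allWords (m a) (k a) :=
  build (ok := fun _ _ => true) hm (by fun_prop) (.const _) (by fun_prop)

/-- The exponentially many words are harmless because `pad` is an argument in unary that caps their
list. The exponent `r` is fixed, and the degree of the polynomial depends on it. -/
theorem solve (r : ℕ) :
    PolyTime fun x : ℕ × (StructCode × StructCode) => solve r x.1 x.2.1 x.2.2 := by
  refine any (f := fun (x : ℕ × (StructCode × StructCode)) m =>
    (List.range (2 * x.2.2.1 + 3)).any fun a => (EmbFPT.allWords x.1 x.2.1.1).any fun c =>
      EmbFPT.solvable ((x.2.2.2.flatten.length + 1) ^ r) x.2.1.1 x.2.2.1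
        (fun f => EmbFPT.tupleOk (EmbFPT.constraints x.2.1.2 x.2.2.2) f &&
          EmbFPT.colorOk (EmbFPT.hashSize x.2.1.1) m a c f)
        (EmbFPT.allWords x.1 x.2.1.1)) (by fun_prop) ?_
  refine any (f := fun (x : (ℕ × (StructCode × StructCode)) × ℕ) a =>
    (EmbFPT.allWords x.1.1 x.1.2.1.1).any fun c =>
      EmbFPT.solvable ((x.1.2.2.2.flatten.length + 1) ^ r) x.1.2.1.1 x.1.2.2.1
        (fun f => EmbFPT.tupleOk (EmbFPT.constraints x.1.2.1.2 x.1.2.2.2) f &&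
          EmbFPT.colorOk (EmbFPT.hashSize x.1.2.1.1) x.2 a c f)
        (EmbFPT.allWords x.1.1 x.1.2.1.1)) (by fun_prop) ?_
  refine any (f := fun (x : ((ℕ × (StructCode × StructCode)) × ℕ) × ℕ) c =>
      EmbFPT.solvable ((x.1.1.2.2.2.flatten.length + 1) ^ r) x.1.1.2.1.1 x.1.1.2.2.1
        (fun f => EmbFPT.tupleOk (EmbFPT.constraints x.1.1.2.1.2 x.1.1.2.2.2) f &&
          EmbFPT.colorOk (EmbFPT.hashSize x.1.1.2.1.1) x.1.2 x.2 c f)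
        (EmbFPT.allWords x.1.1.1 x.1.1.2.1.1)) (by fun_prop) ?_
  refine solvable (ok := fun (x : (((ℕ × (StructCode × StructCode)) × ℕ) × ℕ) × PMap) f =>
      EmbFPT.tupleOk (EmbFPT.constraints x.1.1.1.2.1.2 x.1.1.1.2.2.2) f &&
          EmbFPT.colorOk (EmbFPT.hashSize x.1.1.1.2.1.1) x.1.1.2 x.1.2 x.2 f)
    (pow (by fun_prop) r) (by fun_prop) (by fun_prop) ?_ (by fun_prop)
  exact (tupleOk (constraints (by fun_prop) (by fun_prop)) (by fun_prop)).and
    (colorOk (by fun_prop) (by fun_prop) (by fun_prop) (by fun_prop) (by fun_prop))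

end PolyTime

/-! ### The program and its running time -/

/-- A number that is large enough for enumerating all words. -/
def padSize (k : ℕ) : ℕ := 2 ^ ((k + 1) * hashSize k)

/-- The program doubles `1` in a fold of length `n`. As the unary result is exponential in `n`,
`PolyTime.foldl` does not apply; the time is instead bounded by a polynomial in the value `2 ^ n`.
-/
theorem exists_prog_two_pow : ∃ (p : Prog) (c : ℕ), ∀ n : ℕ,
    ∃ t ≤ (2 ^ n + 10) ^ c, Runs p (enc n) (enc (2 ^ n)) t := by
  have hstep : PolyTime fun p : Unit × (ℕ × Unit) => p.2.1 + p.2.1 := by fun_prop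
  obtain ⟨⟨p, t, ⟨c, ht⟩, hp⟩, -⟩ := hstep
  obtain ⟨q, k, hq⟩ := PolyTime.exists_constProg (enc 1)
  have key : ∀ l : List Unit, l.foldl (fun (s : ℕ) _ => s + s) 1 = 2 ^ l.length := fun l => by
    induction l using List.reverseRecOn with
    | nil => rfl
    | append_singleton l x ih => simp [ih, pow_succ]; omega
  refine ⟨.seq (.pair .zero (.pair .ident q)) (.seq (PolyTime.foldProg p) (.seq .snd .snd)),
    2 * c + k + 5, fun n => ?_⟩
  obtain ⟨m, hm, h1⟩ := PolyTime.runs_foldProg (p := p) () (g := fun (s : ℕ) _ => s + s)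
    (List.replicate n ()) 1 ((2 * 2 ^ n + 10) ^ c) fun l₁ x l₂ e => by
      obtain ⟨m, hm, h1⟩ := hp ((), l₁.foldl (fun (s : ℕ) _ => s + s) 1, x)
      refine ⟨m, hm.trans ((ht _).trans (Nat.pow_le_pow_left ?_ c)), h1⟩
      have : l₁.length ≤ n := by
        have := congrArg List.length e
        simp at this
        omega
      have := Nat.pow_le_pow_right (n := 2) (by omega) this
      rw [key]
      simp only [sz_pair, sz_nat, sz_unit]
      omega
  rw [key, List.length_replicate] at h1
  have h2 : Runs (PolyTime.foldProg p) (.cons .nil (.cons (enc n) (enc 1)))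
      (.cons .nil (.cons .nil (enc (2 ^ n)))) m := by
    rw [← PolyTime.enc_replicate n]
    exact h1
  refine ⟨_, ?_, .seq (.pair (.zero _) (.pair (.ident _) (hq _)))
    (.seq h2 (.seq (.snd_cons _ _) (.snd_cons _ _)))⟩
  have hn : n < 2 ^ n := n.lt_two_pow_self
  rw [List.length_replicate] at hm
  set b := 2 ^ n + 10 with hb
  have hT : (2 * 2 ^ n + 10) ^ c ≤ b ^ (2 * c) := by
    rw [pow_mul]
    exact Nat.pow_le_pow_left (by nlinarith) c
  have h3 : k ≤ b ^ k := k.lt_two_pow_self.le.trans (Nat.pow_le_pow_left (by omega) k)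
  have h4 : n * ((2 * 2 ^ n + 10) ^ c + 30) ≤ b * (b ^ (2 * c) + 3 * b) :=
    Nat.mul_le_mul (by omega) (Nat.add_le_add hT (by omega))
  have h5 : 1 ≤ b ^ (2 * c) := Nat.one_le_pow _ _ (by omega)
  have h6 : 1 ≤ b ^ k := Nat.one_le_pow _ _ (by omega)
  have h7 : 10 ≤ b := by omega
  have e : b ^ (2 * c + k + 5) = b ^ (2 * c) * b ^ k * b ^ 5 := by ring
  rw [e]
  set x := b ^ (2 * c)
  set y := b ^ k
  have h8 : x + y ≤ 2 * (x * y) := by nlinarith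
  have h9 : 1 ≤ x * y := Nat.mul_pos h5 h6
  have h10 : b * (x + 3 * b) + y + 30 ≤ (x * y) * b ^ 5 := by
    have : b * (x + 3 * b) + y + 30 ≤ (x * y) * (b * (1 + 3 * b) + 1 + 30) := by
      have : x ≤ x * y := Nat.le_mul_of_pos_right _ h6
      have : y ≤ x * y := Nat.le_mul_of_pos_left _ h5
      have : b * x ≤ b * (x * y) := Nat.mul_le_mul_left _ ‹_›
      have : 3 * (b * b) * 1 ≤ 3 * (b * b) * (x * y) := Nat.mul_le_mul_left _ h9
      have : (x * y) * (b * (1 + 3 * b) + 1 + 30) =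
        b * (x * y) + 3 * (b * b) * (x * y) + x * y + 30 * (x * y) := by ring
      have : b * (x + 3 * b) = b * x + 3 * (b * b) := by ring
      omega
    refine this.trans (Nat.mul_le_mul_left _ ?_)
    have : b ^ 5 = b * b * (b * b * b) := by ring
    rw [this]
    have : 10 * 10 ≤ b * b := Nat.mul_le_mul h7 h7
    have : 10 * (10 * 10) ≤ b * b * b := by nlinarith
    nlinarith
  omega

theorem exists_prog_solve (r : ℕ) : ∃ (p : Prog) (c : ℕ), ∀ A B : StructCode,
    ∃ t ≤ (padSize A.1 + sz A + sz B + 20) ^ c,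
      Runs p (enc (A, B)) (enc (solve r (padSize A.1) A B)) t := by
  obtain ⟨p₁, c₁, h₁⟩ := exists_prog_two_pow
  have hexp : PolyTime fun x : StructCode × StructCode => (x.1.1 + 1) * hashSize x.1.1 := by
    fun_prop
  obtain ⟨⟨p₂, t₂, ⟨c₂, ht₂⟩, h₂⟩, -⟩ := hexp
  obtain ⟨⟨p₃, t₃, ⟨c₃, ht₃⟩, h₃⟩, -⟩ := PolyTime.solve r
  refine ⟨.seq (.pair (.seq p₂ p₁) .ident) p₃, c₁ + c₂ + 2 * c₃ + 3, fun A B => ?_⟩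
  obtain ⟨n₂, hn₂, r₂⟩ := h₂ (A, B)
  obtain ⟨n₁, hn₁, r₁⟩ := h₁ ((A.1 + 1) * hashSize A.1)
  obtain ⟨n₃, hn₃, r₃⟩ := h₃ (padSize A.1, A, B)
  refine ⟨_, ?_, .seq (.pair (.seq r₂ r₁) (.ident _)) r₃⟩
  replace hn₂ := hn₂.trans (ht₂ _)
  replace hn₃ := hn₃.trans (ht₃ _)
  change n₁ ≤ (padSize A.1 + 10) ^ c₁ at hn₁
  simp only [sz_pair, sz_nat] at hn₂ hn₃
  set b := padSize A.1 + sz A + sz B + 20 with hb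
  have e₁ : n₁ ≤ b ^ c₁ := hn₁.trans (Nat.pow_le_pow_left (by omega) _)
  have e₂ : n₂ ≤ b ^ c₂ := hn₂.trans (Nat.pow_le_pow_left (by omega) _)
  have e₃ : n₃ ≤ b ^ (2 * c₃) := by
    rw [pow_mul]
    exact hn₃.trans (Nat.pow_le_pow_left (by nlinarith) _)
  have q : ∀ i, i ≤ c₁ + c₂ + 2 * c₃ → b ^ i ≤ b ^ (c₁ + c₂ + 2 * c₃) := fun i hi =>
    Nat.pow_le_pow_right (by omega) hi
  have q₁ := q c₁ (by omega)
  have q₂ := q c₂ (by omega)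
  have q₃ := q (2 * c₃) (by omega)
  have q₄ := q 0 (by omega)
  rw [pow_zero] at q₄
  rw [pow_add _ _ 3]
  have : 20 ^ 3 ≤ b ^ 3 := Nat.pow_le_pow_left (by omega) 3
  nlinarith

/-- For `s ≥ 2` the factor `c` and the shift are absorbed into the exponent of `s`. For `s ≤ 1` the
powers of `s` do not grow, and the constant `C` takes over. The clause `c ≤ d` allows the same `d`
to bound the polynomial factor in `time_bound`. -/
theorem two_pow_bound (c : ℕ) : ∃ C d : ℕ, c ≤ d ∧
    ∀ s : ℕ, 2 ^ (c * (s + 1) ^ 3) ≤ C * 2 ^ (s ^ d) := by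
  refine ⟨2 ^ (c * 8), c + 6, by omega, fun s => ?_⟩
  rcases Nat.lt_or_ge s 2 with h | h
  · have h1 : 2 ^ (c * (s + 1) ^ 3) ≤ 2 ^ (c * 8) :=
      Nat.pow_le_pow_right (by omega) (Nat.mul_le_mul_left _
        (Nat.pow_le_pow_left (show s + 1 ≤ 2 by omega) 3))
    exact h1.trans (Nat.le_mul_of_pos_right _ (by positivity))
  · have h1 : c ≤ s ^ c := c.lt_two_pow_self.le.trans (Nat.pow_le_pow_left h c)
    have h2 : (s + 1) ^ 3 ≤ s ^ 6 := by
      rw [show 6 = 2 * 3 by rfl, pow_mul]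
      exact Nat.pow_le_pow_left (by nlinarith) 3
    have h3 : 2 ^ (c * (s + 1) ^ 3) ≤ 2 ^ (s ^ (c + 6)) :=
      Nat.pow_le_pow_right (by omega) (by rw [pow_add]; exact Nat.mul_le_mul h1 h2)
    exact h3.trans (Nat.le_mul_of_pos_left _ (by positivity))

theorem time_bound (c : ℕ) : ∃ C d : ℕ, ∀ k zA zB sA sB : ℕ, k ≤ sA →
    zA ≤ 10 * (sA + 1) ^ 2 → zB ≤ 10 * (sB + 1) ^ 2 →
      (padSize k + zA + zB + 20) ^ c ≤ C * 2 ^ (sA ^ d) * (sB + 1) ^ d := by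
  obtain ⟨C, d, hcd, h⟩ := two_pow_bound (4 * c)
  refine ⟨41 ^ c * C, d, fun k zA zB sA sB hk hA hB => ?_⟩
  have h1 : padSize k ≤ 2 ^ (2 * (sA + 1) ^ 3) := by
    refine Nat.pow_le_pow_right (by omega) ?_
    rw [hashSize]
    calc (k + 1) * (2 * ((k + 1) * (k + 1))) = 2 * (k + 1) ^ 3 := by ring
      _ ≤ _ := Nat.mul_le_mul_left _ (Nat.pow_le_pow_left (by omega) 3)
  have h2 : (sA + 1) ^ 2 ≤ 2 ^ (2 * (sA + 1) ^ 3) := by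
    have : sA + 1 ≤ 2 ^ (sA + 1) := Nat.lt_two_pow_self.le
    refine (Nat.pow_le_pow_left this 2).trans ?_
    rw [← pow_mul]
    refine Nat.pow_le_pow_right (by omega) ?_
    have : 1 ≤ (sA + 1) ^ 2 := Nat.one_le_pow _ _ (by omega)
    nlinarith
  set X := 2 ^ (2 * (sA + 1) ^ 3) with hX
  have h3 : 1 ≤ X := Nat.one_le_two_pow
  set Y := (sB + 1) ^ 2 with hY
  have h4 : 1 ≤ Y := Nat.one_le_pow _ _ (by omega)
  -- The constant is `1 + 10 + 10 + 20`, one term for each summand.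
  have h5 : padSize k + zA + zB + 20 ≤ 41 * (X * Y) := by
    have : X ≤ X * Y := Nat.le_mul_of_pos_right _ h4
    have : Y ≤ X * Y := Nat.le_mul_of_pos_left _ h3
    have : 1 ≤ X * Y := Nat.mul_pos h3 h4
    omega
  calc (padSize k + zA + zB + 20) ^ c ≤ (41 * (X * Y)) ^ c := Nat.pow_le_pow_left h5 c
    _ = 41 ^ c * X ^ c * Y ^ c := by rw [mul_pow, mul_pow, mul_assoc]
    _ ≤ 41 ^ c * (C * 2 ^ (sA ^ d)) * (sB + 1) ^ d := by
        refine Nat.mul_le_mul (Nat.mul_le_mul_left _ ?_) ?_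
        · refine le_trans ?_ (h sA)
          rw [hX, ← pow_mul]
          exact Nat.pow_le_pow_right (by omega) (by nlinarith [Nat.zero_le (c * (sA + 1) ^ 3)])
        · rw [hY, ← pow_mul]
          exact Nat.pow_le_pow_right (by omega) (by omega)
    _ = _ := by simp only [mul_assoc]

/-! ### Structures and their codes -/

section

variable {L : FirstOrder.Language.{0, 0}} {A : Type} {k : ℕ}

/-- The code of a structure. -/
def structCode (syms : List (RelSym L)) (e : A ≃ Fin k)
    (tuples : (R : RelSym L) → List (Fin R.1 → A)) : StructCode :=
  (k, syms.map fun R => (tuples R).map fun a => List.ofFn fun i => (e (a i) : ℕ))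

theorem enc_list {α : Type} [Enc α] (l : List α) : enc l = Sexp.list (l.map enc) := rfl

theorem enc_structCode (syms : List (RelSym L)) (e : A ≃ Fin k)
    (tuples : (R : RelSym L) → List (Fin R.1 → A)) :
    enc (structCode syms e tuples) = .cons (.num k) (.list (syms.map fun R =>
      .list ((tuples R).map fun a => .list (List.ofFn fun i => .num (e (a i) : ℕ))))) := by
  rw [structCode, enc_pair, enc_list, List.map_map]
  congr 3
  funext R
  rw [Function.comp_apply, enc_list, List.map_map]
  congr 2
  funext a
  rw [Function.comp_apply, enc_list, List.map_ofFn]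
  rfl

/-- Each entry of a tuple is a unary number below `k`, hence of size linear in `k`, whereas
`structSize` counts an entry once. This makes the bound quadratic. -/
theorem sz_structCode_le [L.Structure A] [Finite (RelSym L)] (syms : List (RelSym L)) (hn : syms.Nodup)
    (hmem : ∀ R, R ∈ syms) (e : A ≃ Fin k) (tuples : (R : RelSym L) → List (Fin R.1 → A))
    (ht : ∀ R, (tuples R).Nodup)
    (hR : ∀ R a, a ∈ tuples R ↔ FirstOrder.Language.Structure.RelMap R.2 a) :
    k ≤ structSize L A ∧ sz (structCode syms e tuples) ≤ 10 * (structSize L A + 1) ^ 2 := by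
  classical
  have : Fintype (RelSym L) := Fintype.ofFinite _
  have huniv : syms.toFinset = Finset.univ := by ext R; simp [hmem]
  have hk : Nat.card A = k := by rw [Nat.card_congr e, Nat.card_fin]
  have hlen : Nat.card (RelSym L) = syms.length := by
    rw [Nat.card_eq_fintype_card, ← Finset.card_univ, ← huniv, List.toFinset_card_of_nodup hn]
  have hcard : ∀ R : RelSym L,
      Nat.card {a : Fin R.1 → A // FirstOrder.Language.Structure.RelMap R.2 a} =
        (tuples R).length := fun R => by
    rw [← List.toFinset_card_of_nodup (ht R), ← Nat.card_eq_finsetCard]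
    exact Nat.card_congr (Equiv.subtypeEquivRight fun a => by simp [hR])
  have hsize : structSize L A =
      syms.length + k + (syms.map fun R => R.1 * (tuples R).length).sum := by
    rw [structSize, hlen, hk, finsum_eq_sum_of_fintype, ← huniv, List.sum_toFinset _ hn]
    simp only [hcard]
  have hrel : ∀ R : RelSym L,
      sz ((tuples R).map fun a => List.ofFn fun i => (e (a i) : ℕ)) ≤
        (2 * k + 4) * (R.1 * (tuples R).length) + 3 := fun R => by
    have h1 : ∀ a ∈ (tuples R).map fun a => List.ofFn fun i => (e (a i) : ℕ),
        sz a ≤ R.1 * (2 * k + 2) + 1 := by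
      intro x hx
      obtain ⟨a, -, rfl⟩ := List.mem_map.1 hx
      have := sz_le_of_forall (l := List.ofFn fun i => (e (a i) : ℕ)) (k := 2 * k + 1)
        fun y hy => by
          obtain ⟨i, rfl⟩ := (List.mem_ofFn' _ _).1 hy
          have := (e (a i)).2
          simp
      simpa using this
    have h2 := sz_le_of_forall h1
    rw [List.length_map] at h2
    -- Tuples of arity zero contribute nothing to `structSize`, but without repetition there is at
    -- most one of them per relation.
    have h3 : (tuples R).length ≤ R.1 * (tuples R).length + 1 := by
      rcases Nat.eq_zero_or_pos R.1 with h0 | h0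
      · have : Subsingleton (Fin R.1 → A) := by rw [h0]; infer_instance
        have := List.nodup_iff_count_le_one.1 (ht R)
        have h4 : (tuples R).length ≤ 1 := by
          rcases hl : tuples R with _ | ⟨a, _ | ⟨b, l⟩⟩
          · simp
          · simp
          · have := ht R
            rw [hl, Subsingleton.elim b a] at this
            simp at this
        omega
      · nlinarith
    nlinarith
  have hsum : sz (structCode syms e tuples).2 ≤
      (2 * k + 4) * (syms.map fun R => R.1 * (tuples R).length).sum + 4 * syms.length + 1 := by
    rw [structCode]
    clear hn hmem huniv hlen hsize
    induction syms with
    | nil => simp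
    | cons R l ih =>
      have := hrel R
      simp only [List.map_cons, sz_cons, List.sum_cons, List.length_cons, mul_add] at *
      omega
  have : sz (structCode syms e tuples) = 2 * k + 1 + sz (structCode syms e tuples).2 + 1 := by
    rw [← sz_nat]; rfl
  refine ⟨by omega, ?_⟩
  set T := (syms.map fun R => R.1 * (tuples R).length).sum
  nlinarith

end

/-! ### The fractional edge cover bound -/

open Classical in
/-- The bound of Atserias, Grohe and Marx: a set of functions that are determined by their values
on `S` is bounded by the product of the numbers of restrictions to sets that fractionally
cover `S`. -/
theorem card_le_prod_card_restrict_rpow {V β ι : Type} (edge : ι → Set V) (I : Finset ι)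
    (γ : ι → ℝ) (hγ : ∀ i ∈ I, 0 ≤ γ i) (S : Finset V)
    (hS : ∀ v ∈ S, 1 ≤ ∑ i ∈ I with v ∈ edge i, γ i) (P : Finset (V → β))
    (hP : ∀ f ∈ P, ∀ g ∈ P, (∀ v ∈ S, f v = g v) → f = g) :
    (P.card : ℝ) ≤ ∏ i ∈ I, ((P.image (edge i).domRestrict).card : ℝ) ^ γ i := by
  induction S using Finset.induction_on generalizing P with
  | empty =>
    rcases P.eq_empty_or_nonempty with rfl | hne
    · simpa using Finset.prod_nonneg fun i _ => Real.rpow_nonneg le_rfl (γ i)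
    · have h1 : P.card ≤ 1 := Finset.card_le_one.2 fun f hf g hg => hP f hf g hg (by simp)
      calc (P.card : ℝ) ≤ 1 := by exact_mod_cast h1
        _ = ∏ i ∈ I, (1 : ℝ) := by simp
        _ ≤ _ := Finset.prod_le_prod (fun _ _ => zero_le_one) fun i hi => by
          refine Real.one_le_rpow ?_ (hγ i hi)
          exact_mod_cast Finset.card_pos.2 (hne.image _)
  | insert v S _ ih =>
    rcases P.eq_empty_or_nonempty with rfl | hne
    · simpa using Finset.prod_nonneg fun i _ => Real.rpow_nonneg le_rfl (γ i)
    set T := P.image fun f => f v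
    -- The set is split into fibres according to the value at `v`, and induction applies to each
    -- fibre. The ratio `x i b / X i` is the share of fibre `b` among the restrictions to edge `i`.
    -- If `v` lies in that edge, different fibres have disjoint sets of restrictions, so the shares
    -- sum to at most `1`; for other edges each share is at most `1`.
    set Q : β → Finset (V → β) := fun b => P.filter fun f => f v = b
    set X : ι → ℝ := fun i => ((P.image (edge i).domRestrict).card : ℝ)
    set x : ι → β → ℝ := fun i b => (((Q b).image (edge i).domRestrict).card : ℝ)
    have hX : ∀ i, 0 < X i := fun i =>
      Nat.cast_pos.2 (Finset.card_pos.2 (hne.image _))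
    have hx : ∀ i b, 0 ≤ x i b := fun i b => Nat.cast_nonneg _
    have hxX : ∀ i b, x i b / X i ≤ 1 := fun i b => by
      rw [div_le_one (hX i)]
      exact Nat.cast_le.2
        (Finset.card_le_card (Finset.image_subset_image (Finset.filter_subset _ _)))
    have hy : ∀ i b, 0 ≤ x i b / X i := fun i b => div_nonneg (hx i b) (hX i).le
    have hsum : ∀ i, v ∈ edge i → ∑ b ∈ T, x i b / X i ≤ 1 := fun i hi => by
      rw [← Finset.sum_div, div_le_one (hX i)]
      have hdis : (T : Set β).PairwiseDisjoint fun b => (Q b).image (edge i).domRestrict := by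
        intro b _ c _ hbc
        rw [Function.onFun, Finset.disjoint_left]
        intro f hf hf'
        obtain ⟨g, hg, rfl⟩ := Finset.mem_image.1 hf
        obtain ⟨g', hg', e⟩ := Finset.mem_image.1 hf'
        have := congrFun e ⟨v, hi⟩
        exact hbc (by rw [← (Finset.mem_filter.1 hg).2, ← (Finset.mem_filter.1 hg').2]; exact this.symm)
      have := Finset.card_biUnion hdis
      have h2 : (T.biUnion fun b => (Q b).image (edge i).domRestrict).card ≤
          (P.image (edge i).domRestrict).card :=
        Finset.card_le_card (Finset.biUnion_subset.2 fun b _ =>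
          Finset.image_subset_image (Finset.filter_subset _ _))
      rw [this] at h2
      simp only [x, X, ← Nat.cast_sum]
      exact Nat.cast_le.2 h2
    set J := I.filter fun i => v ∈ edge i
    have hJ : ∀ i ∈ J, i ∈ I ∧ v ∈ edge i := fun i hi => Finset.mem_filter.1 hi
    set Γ := ∑ i ∈ J, γ i
    have hΓ : 1 ≤ Γ := hS v (Finset.mem_insert_self v S)
    have hw : ∑ i ∈ J, γ i / Γ = 1 := by
      rw [← Finset.sum_div, div_self (by positivity)]
    have hfib : ∀ b, ((Q b).card : ℝ) ≤ (∏ i ∈ I, X i ^ γ i) * ∑ i ∈ J, γ i / Γ * (x i b / X i) := by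
      intro b
      have h1 : ((Q b).card : ℝ) ≤ ∏ i ∈ I, x i b ^ γ i :=
        ih (fun w hw => hS w (Finset.mem_insert_of_mem hw)) (Q b) fun f hf g hg h => by
          obtain ⟨hf, hf'⟩ := Finset.mem_filter.1 hf
          obtain ⟨hg, hg'⟩ := Finset.mem_filter.1 hg
          refine hP f hf g hg fun w hw => ?_
          rcases Finset.mem_insert.1 hw with rfl | hw
          · rw [hf', hg']
          · exact h w hw
      have h2 : ∏ i ∈ I, x i b ^ γ i = (∏ i ∈ I, X i ^ γ i) * ∏ i ∈ I, (x i b / X i) ^ γ i := by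
        rw [← Finset.prod_mul_distrib]
        refine Finset.prod_congr rfl fun i _ => ?_
        rw [← Real.mul_rpow (hX i).le (hy i b), mul_div_cancel₀ _ (hX i).ne']
      have h3 : ∏ i ∈ I, (x i b / X i) ^ γ i ≤ ∏ i ∈ J, (x i b / X i) ^ γ i := by
        rw [← Finset.prod_filter_mul_prod_filter_not I (fun i => v ∈ edge i)]
        refine mul_le_of_le_one_right (Finset.prod_nonneg fun i _ => Real.rpow_nonneg (hy i b) _) ?_
        exact Finset.prod_le_one (fun i _ => Real.rpow_nonneg (hy i b) _) fun i hi =>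
          Real.rpow_le_one (hy i b) (hxX i b) (hγ i (Finset.mem_filter.1 hi).1)
      -- Shares are at most `1` and `Γ ≥ 1`, so dividing the exponents by `Γ` only enlarges the
      -- product. The new exponents sum to `1`, as the weighted inequality of means requires.
      have h4 : ∏ i ∈ J, (x i b / X i) ^ γ i ≤ ∏ i ∈ J, (x i b / X i) ^ (γ i / Γ) := by
        refine Finset.prod_le_prod (fun i _ => Real.rpow_nonneg (hy i b) _) fun i hi => ?_
        have hi' := hγ i (hJ i hi).1
        have hle : γ i / Γ ≤ γ i := div_le_self hi' hΓ
        rcases (hy i b).eq_or_lt with h0 | h0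
        · rw [← h0]
          rcases hi'.eq_or_lt with h5 | h5
          · simp [← h5]
          · rw [Real.zero_rpow h5.ne']
            exact Real.rpow_nonneg le_rfl _
        · exact Real.rpow_le_rpow_of_exponent_ge h0 (hxX i b) hle
      have h5 := Real.geom_mean_le_arith_mean_weighted J (fun i => γ i / Γ) (fun i => x i b / X i)
        (fun i hi => div_nonneg (hγ i (hJ i hi).1) (by positivity)) hw fun i _ => hy i b
      rw [h2] at h1
      exact h1.trans (mul_le_mul_of_nonneg_left (h3.trans (h4.trans h5))
        (Finset.prod_nonneg fun i _ => Real.rpow_nonneg (hX i).le _))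
    have hcard : (P.card : ℝ) = ∑ b ∈ T, ((Q b).card : ℝ) := by
      exact_mod_cast Finset.card_eq_sum_card_image (fun f => f v) P
    have hnn : 0 ≤ ∏ i ∈ I, X i ^ γ i :=
      Finset.prod_nonneg fun i _ => Real.rpow_nonneg (hX i).le _
    calc (P.card : ℝ) ≤ ∑ b ∈ T, (∏ i ∈ I, X i ^ γ i) * ∑ i ∈ J, γ i / Γ * (x i b / X i) := by
          rw [hcard]
          exact Finset.sum_le_sum fun b _ => hfib b
      _ = (∏ i ∈ I, X i ^ γ i) * ∑ i ∈ J, γ i / Γ * ∑ b ∈ T, x i b / X i := by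
          rw [← Finset.mul_sum, Finset.sum_comm]
          simp only [Finset.mul_sum]
      _ ≤ (∏ i ∈ I, X i ^ γ i) * ∑ i ∈ J, γ i / Γ * 1 := by
          refine mul_le_mul_of_nonneg_left (Finset.sum_le_sum fun i hi =>
            mul_le_mul_of_nonneg_left (hsum i (hJ i hi).2)
              (div_nonneg (hγ i (hJ i hi).1) (by positivity))) hnn
      _ = ∏ i ∈ I, X i ^ γ i := by simp only [mul_one, hw]

/-! ### Gluing along a tree -/

open SimpleGraph in
/-- Locally consistent choices on the bags of a tree decomposition can be glued. -/
theorem exists_glue {N V β : Type} {T : SimpleGraph N} (hT : T.IsTree) (bag : N → Set V)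
    (hconn : ∀ v, (T.induce {t | v ∈ bag t}).Connected) (R : N → Set (V → β))
    (hne : ∀ t, (R t).Nonempty)
    (hR : ∀ t s, ∀ f ∈ R t, ∃ g ∈ R s, ∀ v ∈ bag t, v ∈ bag s → f v = g v) :
    ∃ h : V → β, ∀ t, ∃ f ∈ R t, ∀ v ∈ bag t, h v = f v := by
  classical
  obtain ⟨root⟩ := hT.connected.nonempty
  let step : ∀ t s, R t → R s := fun t s f => ⟨(hR t s f f.2).choose, (hR t s f f.2).choose_spec.1⟩
  have hstep : ∀ t s (f : R t), ∀ v ∈ bag t, v ∈ bag s → f.1 v = (step t s f).1 v := fun t s f =>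
    (hR t s f f.2).choose_spec.2
  let along : ∀ {t s : N}, T.Walk t s → R s → R t := fun {t s} p =>
    Walk.rec (motive := fun t s _ => R s → R t) (fun f => f)
      (fun {t u _} _ _ ih f => step u t (ih f)) p
  let path : ∀ t, T.Walk t root := fun t => (hT.existsUnique_path t root).choose
  have hpath : ∀ t, (path t).IsPath := fun t => (hT.existsUnique_path t root).choose_spec.1
  have huniq : ∀ t (q : T.Walk t root), q.IsPath → q = path t := fun t q hq =>
    (hT.existsUnique_path t root).choose_spec.2 q hq
  -- One choice at the root is transported to each node along the unique path.
  let Φ : ∀ t, R t := fun t => along (path t) ⟨(hne root).some, (hne root).some_mem⟩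
  have hcons : ∀ t s (h : T.Adj t s), t ∉ (path s).support → Φ t = step s t (Φ s) := by
    intro t s h ht
    have : path t = .cons h (path s) := (huniq t _ ((hpath s).cons ht)).symm
    simp only [Φ, this]
    rfl
  -- Of two adjacent nodes, one is the parent of the other with respect to the root, and the choice
  -- at the child was made consistent with that of the parent.
  have hadj : ∀ t s, T.Adj t s → ∀ v ∈ bag t, v ∈ bag s → (Φ t).1 v = (Φ s).1 v := by
    intro t s h v hvt hvs
    by_cases ht : t ∈ (path s).support
    · have hs : s ∉ (path t).support := by
        have := hT.isAcyclic.ne_mem_support_of_support_of_adj_of_isPath (p := (path s).reverse)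
          (q := (path t).reverse) (by simpa using hpath s) (by simpa using hpath t)
          h.symm (by simpa using ht)
        simpa using this
      rw [hcons s t h.symm hs, ← hstep t s _ v hvt hvs]
    · rw [hcons t s h ht, ← hstep s t _ v hvs hvt]
  -- The nodes whose bags contain `v` are connected, so the equalities along edges chain together.
  have hsame : ∀ v t s, v ∈ bag t → v ∈ bag s → (Φ t).1 v = (Φ s).1 v := by
    intro v t s ht hs
    obtain ⟨w⟩ := (hconn v).preconnected ⟨t, ht⟩ ⟨s, hs⟩
    have : ∀ (a b : {t | v ∈ bag t}) (w : (T.induce {t | v ∈ bag t}).Walk a b),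
        (Φ a).1 v = (Φ b).1 v := by
      intro a b w
      induction w with
      | nil => rfl
      | @cons a b _ h _ ih => exact (hadj _ _ h v a.2 b.2).trans ih
    exact this _ _ w
  have hnode : ∀ v, ∃ t, v ∈ bag t := fun v => by
    obtain ⟨t⟩ := (hconn v).nonempty
    exact ⟨t, t.2⟩
  choose node hnode using hnode
  exact ⟨fun v => (Φ (node v)).1 v, fun t => ⟨(Φ t).1, (Φ t).2, fun v hv =>
    hsame v _ t (hnode v) hv⟩⟩

/-! ### Hashing -/

theorem hashSize_pos (k : ℕ) : 0 < hashSize k := by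
  unfold hashSize
  positivity

/-- Few multipliers make two given numbers collide. -/
theorem card_collisions_le {p q x y : ℕ} (hp : p.Prime) (hq : 0 < q) (hx : x < p) (hy : y < p)
    (hxy : x ≠ y) :
    ((Finset.Ico 1 p).filter fun a => hash q p a x = hash q p a y).card * q ≤ 2 * (p - 1) := by
  set S := (Finset.Ico 1 p).filter fun a => hash q p a x = hash q p a y
  have hp0 : (0 : ℤ) < p := by exact_mod_cast hp.pos
  -- The difference `d a` of the residues is congruent to `a * (x - y)` modulo `p`, so it is
  -- non-zero and determines `a`. A collision makes it a multiple of `q` of absolute value at most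
  -- `p - 1`. Hence `d a / q` takes at most `2 * ((p - 1) / q)` values.
  let d : ℕ → ℤ := fun a => ((a * x % p : ℕ) : ℤ) - ((a * y % p : ℕ) : ℤ)
  have hd : ∀ a, (d a - a * ((x : ℤ) - y)) % p = 0 := fun a => by
    have : d a - a * ((x : ℤ) - y) =
        (p : ℤ) * ((a * y / p : ℕ) - (a * x / p : ℕ) : ℤ) := by
      have h1 := Nat.mod_add_div (a * x) p
      have h2 := Nat.mod_add_div (a * y) p
      zify at h1 h2
      simp only [d]
      push_cast
      linear_combination h1 - h2
    rw [this]
    exact Int.mul_emod_right _ _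
  have hndvd : ¬ (p : ℤ) ∣ (x : ℤ) - y := fun h => by
    have := Int.eq_zero_of_abs_lt_dvd h (by rw [abs_lt]; omega)
    omega
  have hpp : Prime (p : ℤ) := Nat.prime_iff_prime_int.1 hp
  have hqd : ∀ a ∈ S, (q : ℤ) ∣ d a := fun a ha => by
    have h : a * x % p % q = a * y % p % q := (Finset.mem_filter.1 ha).2
    have h' : ((a * y % p : ℕ) : ℤ) ≡ ((a * x % p : ℕ) : ℤ) [ZMOD q] := by
      rw [Int.ModEq]
      exact_mod_cast h.symm
    exact h'.dvd
  have hmaps : ∀ a ∈ S,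
      d a / q ∈ (Finset.Icc (-(((p - 1) / q : ℕ) : ℤ)) ((p - 1) / q : ℕ)).erase 0 := by
    intro a ha
    obtain ⟨z, hz⟩ := hqd a ha
    have hq' : (0 : ℤ) < q := by exact_mod_cast hq
    have h0 : d a ≠ 0 := fun h0 => by
      have h1 := hd a
      rw [h0, zero_sub, ← Int.dvd_iff_emod_eq_zero, dvd_neg] at h1
      rcases hpp.dvd_or_dvd h1 with h | h
      · have h2 := Finset.mem_Ico.1 (Finset.mem_filter.1 ha).1
        have := Nat.le_of_dvd (by omega) (Int.natCast_dvd_natCast.1 h)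
        omega
      · exact hndvd h
    have h1 := Nat.mod_lt (a * x) hp.pos
    have h2 := Nat.mod_lt (a * y) hp.pos
    have h3 : |d a| ≤ (p - 1 : ℕ) := by
      rw [abs_le]
      simp only [d]
      omega
    rw [hz, Int.mul_ediv_cancel_left _ hq'.ne']
    have hz0 : z ≠ 0 := fun h => h0 (by rw [hz, h, mul_zero])
    have h4 : |z| ≤ ((p - 1) / q : ℕ) := by
      rw [hz, abs_mul, abs_of_pos hq'] at h3
      rw [Int.natCast_div, Int.le_ediv_iff_mul_le hq', mul_comm]
      exact h3
    exact Finset.mem_erase.2 ⟨hz0, Finset.mem_Icc.2 (abs_le.1 h4)⟩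
  have hinj : Set.InjOn (fun a => d a / q) S := by
    intro a ha b hb hab
    have e : d a = d b := by
      rw [← Int.ediv_mul_cancel (hqd a ha), ← Int.ediv_mul_cancel (hqd b hb)]
      exact congrArg (· * (q : ℤ)) hab
    have h1 : (p : ℤ) ∣ ((a : ℤ) - b) * (x - y) := by
      have h2 := Int.dvd_of_emod_eq_zero (hd a)
      have h3 := Int.dvd_of_emod_eq_zero (hd b)
      have h4 : ((a : ℤ) - b) * (x - y) =
          (d b - b * ((x : ℤ) - y)) - (d a - a * ((x : ℤ) - y)) := by
        rw [e]
        ring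
      exact h4 ▸ dvd_sub h3 h2
    have h2 := Finset.mem_Ico.1 (Finset.mem_filter.1 ha).1
    have h3 := Finset.mem_Ico.1 (Finset.mem_filter.1 hb).1
    rcases hpp.dvd_or_dvd h1 with h | h
    · have := Int.eq_zero_of_abs_lt_dvd h (by rw [abs_lt]; omega)
      omega
    · exact absurd h hndvd
  have hcard := Finset.card_le_card_of_injOn _ hmaps hinj
  have h6 := Nat.div_mul_le_self (p - 1) q
  generalize (p - 1) / q = D at hcard h6
  have h0 : (0 : ℤ) ∈ Finset.Icc (-(D : ℤ)) D := by
    rw [Finset.mem_Icc]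
    omega
  rw [Finset.card_erase_of_mem h0, Int.card_Icc] at hcard
  have h5 : S.card ≤ 2 * D := by omega
  nlinarith

/-- The hash functions contain one that is injective on a given small set. -/
theorem exists_hash_injective {k n : ℕ} (h : Fin k → ℕ) (hinj : Function.Injective h)
    (hlt : ∀ i, h i < n) : ∃ m < 2 * n + 3, ∃ a < 2 * n + 3,
      Function.Injective fun i => hash (hashSize k) m a (h i) := by
  -- Bertrand's postulate at `n + 1` also covers `n = 0`.
  obtain ⟨p, hp, hnp, hp2⟩ := Nat.exists_prime_lt_and_le_two_mul (n + 1) (by omega)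
  refine ⟨p, by omega, ?_⟩
  by_contra hcon
  have hbad : ∀ a ∈ Finset.Ico 1 p, ∃ ij ∈ (Finset.univ : Finset (Fin k × Fin k)).filter
      (fun ij => ij.1 ≠ ij.2),
      hash (hashSize k) p a (h ij.1) = hash (hashSize k) p a (h ij.2) := fun a ha => by
    by_contra hno
    refine hcon ⟨a, by have := (Finset.mem_Ico.1 ha).2; omega, fun i j hij => ?_⟩
    by_contra hne
    exact hno ⟨(i, j), by simpa using hne, hij⟩
  have hsub : Finset.Ico 1 p ⊆ ((Finset.univ : Finset (Fin k × Fin k)).filter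
      (fun ij => ij.1 ≠ ij.2)).biUnion fun ij => (Finset.Ico 1 p).filter fun a =>
        hash (hashSize k) p a (h ij.1) = hash (hashSize k) p a (h ij.2) := fun a ha => by
    obtain ⟨ij, hij, e⟩ := hbad a ha
    exact Finset.mem_biUnion.2 ⟨ij, hij, Finset.mem_filter.2 ⟨ha, e⟩⟩
  have h1 := (Finset.card_le_card hsub).trans Finset.card_biUnion_le
  rw [Nat.card_Ico] at h1
  -- Union bound: if every multiplier failed, at most `k * k` pairs would account for all `p - 1` of
  -- them. This contradicts `hashSize k > 2 * k * k`.
  have h2 : (p - 1) * hashSize k ≤ (k * k) * (2 * (p - 1)) := by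
    refine (Nat.mul_le_mul_right _ h1).trans ?_
    rw [Finset.sum_mul]
    refine (Finset.sum_le_card_nsmul _ _ (2 * (p - 1)) fun ij hij => ?_).trans ?_
    · exact card_collisions_le hp (hashSize_pos k) (by have := hlt ij.1; omega)
        (by have := hlt ij.2; omega) (hinj.ne (Finset.mem_filter.1 hij).2)
    · rw [smul_eq_mul]
      refine Nat.mul_le_mul_right _ ((Finset.card_filter_le _ _).trans ?_)
      simp
  have h3 : 1 ≤ p - 1 := by have := hp.two_le; omega
  rw [hashSize] at h2
  nlinarith

/-! ### Pairwise consistency -/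

theorem agree_iff {f g : PMap} : agree f g = true ↔
    ∀ p ∈ f, ∀ r ∈ g, p.1 = r.1 → p.2 = r.2 := by
  simp only [agree, List.all_eq_true, Bool.or_eq_true, Bool.not_eq_true', decide_eq_false_iff_not,
    decide_eq_true_eq, imp_iff_not_or]

/-- The total number of maps is the potential that makes the deletion process stop. -/
theorem map_filter_eq_or_lt {α : Type} (P : α → Bool) (F : List (List α)) :
    (F.map fun R => R.filter P).flatten.length ≤ F.flatten.length ∧
      ((F.map fun R => R.filter P) = F ∨
        (F.map fun R => R.filter P).flatten.length < F.flatten.length) := by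
  induction F with
  | nil => simp
  | cons R F ih =>
    have h1 := List.length_filter_le P R
    obtain ⟨h2, h3⟩ := ih
    simp only [List.map_cons, List.flatten_cons, List.length_append]
    refine ⟨by omega, ?_⟩
    rcases h3 with h3 | h3
    · by_cases h4 : R.filter P = R
      · exact .inl (by rw [h3, h4])
      · have : (R.filter P).length ≠ R.length := fun h =>
          h4 (List.filter_sublist.eq_of_length h)
        exact .inr (by omega)
    · exact .inr (by omega)

theorem consRound_iterate_eq (n : ℕ) (F : List (List PMap)) (h : F.flatten.length ≤ n) :
    consRound (consRound^[n] F) = consRound^[n] F := by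
  induction n generalizing F with
  | zero =>
    rcases (map_filter_eq_or_lt (fun f => F.all fun S => S.any fun g => agree f g) F).2 with h1 | h1
    · exact h1
    · omega
  | succ n ih =>
    rcases (map_filter_eq_or_lt (fun f => F.all fun S => S.any fun g => agree f g) F).2 with h1 | h1
    · have h1 : consRound F = F := h1
      rw [Function.iterate_fixed h1, h1]
    · rw [Function.iterate_succ_apply]
      exact ih _ (by rw [consRound]; omega)

/-- The result of the iteration is pairwise consistent. -/
theorem exists_agree_of_mem_consFix {F : List (List PMap)} {R S : List PMap} {f : PMap}
    (hR : R ∈ consFix F) (hf : f ∈ R) (hS : S ∈ consFix F) : ∃ g ∈ S, agree f g = true := by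
  have h1 := consRound_iterate_eq _ F le_rfl
  change consRound (consFix F) = consFix F at h1
  have h2 : (consFix F).map _ = (consFix F).map fun R => R := h1.trans (List.map_id' _).symm
  have h3 := List.map_inj_left.1 h2 R hR
  rw [← h3] at hf
  have h4 := (List.mem_filter.1 hf).2
  simp only [List.all_eq_true, List.any_eq_true] at h4
  exact h4 S hS

/-- Rounds shrink lists but never remove one, so each candidate has a descendant in the fixed point.
-/
theorem exists_subset_mem_iterate {F : List (List PMap)} {R : List PMap} (hR : R ∈ F) (n : ℕ) :
    ∃ S ∈ consRound^[n] F, S ⊆ R := by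
  induction n with
  | zero => exact ⟨R, hR, fun _ h => h⟩
  | succ n ih =>
    obtain ⟨S, hS, h⟩ := ih
    rw [Function.iterate_succ_apply']
    exact ⟨_, List.mem_map_of_mem hS, fun f hf => h (List.mem_of_mem_filter hf)⟩

/-- Restrictions of a single function are never deleted. -/
theorem exists_restriction_mem_iterate {F : List (List PMap)} (h : ℕ → ℕ)
    (hF : ∀ R ∈ F, ∃ f ∈ R, ∀ p ∈ f, p.2 = h p.1) (n : ℕ) :
    ∀ R ∈ consRound^[n] F, ∃ f ∈ R, ∀ p ∈ f, p.2 = h p.1 := by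
  induction n with
  | zero => exact hF
  | succ n ih =>
    rw [Function.iterate_succ_apply']
    intro R hR
    obtain ⟨S, hS, rfl⟩ := List.mem_map.1 hR
    obtain ⟨f, hf, hfh⟩ := ih S hS
    refine ⟨f, List.mem_filter.2 ⟨hf, ?_⟩, hfh⟩
    simp only [List.all_eq_true, List.any_eq_true]
    intro T hT
    obtain ⟨g, hg, hgh⟩ := ih T hT
    exact ⟨g, hg, agree_iff.2 fun p hp r hr e => by rw [hfh p hp, hgh r hr, e]⟩

/-! ### The lists of partial maps -/

/-- The list of all partial maps from `vs` to `dom` that satisfy `ok`. -/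
def partials (dom : List ℕ) (ok : PMap → Bool) : List ℕ → List PMap
  | [] => [[]].filter ok
  | v :: vs => ((partials dom ok vs).flatMap fun f => dom.map fun b => (v, b) :: f).filter ok

theorem build_cons_of_le {M : ℕ} {dom : List ℕ} {ok : PMap → Bool} {vs : List ℕ} (v : ℕ)
    (h : build M dom ok vs = partials dom ok vs) (hle : (partials dom ok vs).length ≤ M) :
    build M dom ok (v :: vs) = partials dom ok (v :: vs) := by
  change extend M dom ok v (build M dom ok vs) = _
  rw [h, extend, decide_eq_true hle]
  rfl

/-- The lists met on the way are those of the suffixes of `vs`, so the cap is never reached. For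
subsets of a bag the hypothesis holds because suffixes are again subsets of the bag. -/
theorem build_eq_partials {M : ℕ} {dom : List ℕ} {ok : PMap → Bool} {vs : List ℕ}
    (h : ∀ us, us <:+ vs → (partials dom ok us).length ≤ M) :
    build M dom ok vs = partials dom ok vs := by
  induction vs with
  | nil => rfl
  | cons v vs ih =>
    have h' : ∀ us, us <:+ vs → (partials dom ok us).length ≤ M := fun us hus =>
      h us (hus.trans (List.suffix_cons v vs))
    exact build_cons_of_le v (ih h') (h' vs List.suffix_rfl)

/-- Once a list is too long it is left alone and so stays too long. Therefore the length filter in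
`candidates` removes every incomplete list. -/
theorem build_eq_partials_of_length_le {M : ℕ} {dom : List ℕ} {ok : PMap → Bool} {vs : List ℕ}
    (h : (build M dom ok vs).length ≤ M) : build M dom ok vs = partials dom ok vs := by
  induction vs with
  | nil => rfl
  | cons v vs ih =>
    by_cases hle : (build M dom ok vs).length ≤ M
    · exact build_cons_of_le v (ih hle) (ih hle ▸ hle)
    · have h : (extend M dom ok v (build M dom ok vs)).length ≤ M := h
      rw [extend, decide_eq_false hle] at h
      exact absurd h hle

variable {dom : List ℕ} {ok : PMap → Bool} {vs : List ℕ} {f : PMap}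

/-- Filtering at every stage loses nothing, because `ok` passes from a partial map to its tails. -/
theorem mem_partials (hok : ∀ p f, ok (p :: f) = true → ok f = true) :
    f ∈ partials dom ok vs ↔ ok f = true ∧ f.map Prod.fst = vs ∧ ∀ p ∈ f, p.2 ∈ dom := by
  induction vs generalizing f with
  | nil =>
    simp only [partials, List.mem_filter, List.mem_singleton, List.map_eq_nil_iff]
    constructor
    · rintro ⟨rfl, h⟩
      simp [h]
    · rintro ⟨h, rfl, -⟩
      exact ⟨rfl, h⟩
  | cons v vs ih =>
    simp only [partials, List.mem_filter, List.mem_flatMap, List.mem_map]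
    constructor
    · rintro ⟨⟨g, hg, b, hb, rfl⟩, h⟩
      obtain ⟨h1, h2, h3⟩ := ih.1 hg
      refine ⟨h, by simp [h2], fun p hp => ?_⟩
      rcases List.mem_cons.1 hp with rfl | hp
      · exact hb
      · exact h3 p hp
    · rintro ⟨h, h1, h2⟩
      rcases f with _ | ⟨⟨w, b⟩, g⟩
      · simp at h1
      · simp only [List.map_cons, List.cons.injEq] at h1
        obtain ⟨rfl, h1⟩ := h1
        exact ⟨⟨g, ih.2 ⟨hok _ _ h, h1, fun p hp => h2 p (List.mem_cons_of_mem _ hp)⟩, b,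
          h2 (w, b) List.mem_cons_self, rfl⟩, h⟩

theorem nodup_partials (hdom : dom.Nodup) : (partials dom ok vs).Nodup := by
  induction vs with
  | nil => exact (List.nodup_singleton _).filter _
  | cons v vs ih =>
    refine List.Nodup.filter _ (List.nodup_flatMap.2 ⟨fun f _ => hdom.map ?_, ?_⟩)
    · intro b c h
      simpa using h
    · refine ih.pairwise_of_forall_ne fun f _ g _ hfg => ?_
      rw [Function.onFun, List.disjoint_left]
      intro x hx hx'
      obtain ⟨b, -, rfl⟩ := List.mem_map.1 hx
      obtain ⟨c, -, e⟩ := List.mem_map.1 hx'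
      simp only [List.cons.injEq] at e
      exact hfg e.2.symm

theorem length_partials_le : (partials dom ok vs).length ≤ dom.length ^ vs.length := by
  induction vs with
  | nil => exact (List.length_filter_le _ _).trans (by simp)
  | cons v vs ih =>
    refine (List.length_filter_le _ _).trans ?_
    rw [List.length_flatMap]
    simp only [List.length_map, List.map_const', List.sum_replicate, smul_eq_mul,
      List.length_cons, pow_succ]
    exact Nat.mul_le_mul_right _ ih

/-- There are `(k + 1) ^ hashSize k` words, and `k + 1 ≤ 2 ^ (k + 1)` bounds this number by `padSize
k`. -/
theorem allWords_eq {k pad : ℕ} (hpad : padSize k ≤ pad) :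
    allWords pad k =
      partials (List.range (k + 1)) (fun _ => true) (List.range (hashSize k)) := by
  refine build_eq_partials fun us hus => length_partials_le.trans (le_trans ?_ hpad)
  have h1 := hus.length_le
  rw [List.length_range] at h1 ⊢
  calc (k + 1) ^ us.length ≤ (k + 1) ^ hashSize k := Nat.pow_le_pow_right (by omega) h1
    _ ≤ (2 ^ (k + 1)) ^ hashSize k := Nat.pow_le_pow_left Nat.lt_two_pow_self.le _
    _ = padSize k := by rw [← pow_mul, padSize]

theorem mem_allWords {k pad : ℕ} (hpad : padSize k ≤ pad) {w : PMap} :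
    w ∈ allWords pad k ↔ w.map Prod.fst = List.range (hashSize k) ∧ ∀ p ∈ w, p.2 ≤ k := by
  rw [allWords_eq hpad, mem_partials (by simp)]
  simp

/-- The value of a partial map, and `0` outside its domain. -/
def PMap.val : PMap → ℕ → ℕ
  | [], _ => 0
  | p :: f, v => if p.1 = v then p.2 else PMap.val f v

theorem PMap.val_eq_zero {v : ℕ} (h : v ∉ f.map Prod.fst) : PMap.val f v = 0 := by
  induction f with
  | nil => rfl
  | cons p f ih =>
    simp only [List.map_cons, List.mem_cons, not_or] at h
    rw [PMap.val, if_neg (Ne.symm h.1), ih h.2]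

theorem PMap.mk_val_mem {v : ℕ} (h : v ∈ f.map Prod.fst) : (v, PMap.val f v) ∈ f := by
  induction f with
  | nil => simp at h
  | cons p f ih =>
    by_cases hp : p.1 = v
    · subst hp
      simp [PMap.val]
    · simp only [List.map_cons, List.mem_cons] at h
      rw [PMap.val, if_neg hp]
      exact List.mem_cons_of_mem _ (ih (h.resolve_left (Ne.symm hp)))

theorem PMap.eq_map_val (h : (f.map Prod.fst).Nodup) :
    f = (f.map Prod.fst).map fun v => (v, PMap.val f v) := by
  induction f with
  | nil => rfl
  | cons p f ih =>
    rw [List.map_cons, List.nodup_cons] at h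
    rw [List.map_cons, List.map_cons]
    congr 1
    · simp [PMap.val]
    · nth_rewrite 1 [ih h.2]
      refine List.map_congr_left fun v hv => ?_
      have : p.1 ≠ v := fun e => h.1 (e ▸ hv)
      rw [PMap.val, if_neg this]

/-! ### Correctness of the consistency test -/

section

variable {A : Type} {k : ℕ} {ok : PMap → Bool}

/-- On a set of elements that lies in a bag of a decomposition of small width there are few partial
maps that satisfy all constraints. -/
theorem length_partials_le_pow [Finite A] (e : A ≃ Fin k) {H : Hypergraph A}
    (D : FracHypertreeDecomp H) {dom : List ℕ} (hdom : dom.Nodup)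
    (hok : ∀ p f, ok (p :: f) = true → ok f = true) {N r : ℕ} (hN : 1 ≤ N) (hr : D.width ≤ r)
    (hE : ∀ E ∈ H.edgeSet, ∃ (n : ℕ) (a : Fin n → A) (rb : List (List ℕ)), E = Set.range a ∧
      (∀ u ∈ rb, u.length = n) ∧ rb.length ≤ N ∧ ∀ f, ok f = true → ∃ u ∈ rb,
        agree ((List.ofFn fun i => (e (a i) : ℕ)).zip u) f = true)
    (t : D.Node) {vs : List ℕ} (hnd : vs.Nodup) (hvs : ∀ v ∈ vs, ∃ a ∈ D.bag t, (e a : ℕ) = v) :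
    (partials dom ok vs).length ≤ N ^ r := by
  classical
  have := Fintype.ofFinite A
  have := Fintype.ofFinite H.edgeSet
  have hkeys : ∀ f ∈ partials dom ok vs, f.map Prod.fst = vs := fun f hf =>
    ((mem_partials hok).1 hf).2.1
  -- The partial maps become total functions, with value `0` off `vs`, so that the fractional edge
  -- cover bound applies. Distinct partial maps stay distinct.
  set F : PMap → A → ℕ := fun f a => PMap.val f (e a)
  set P := (partials dom ok vs).toFinset.image F
  have hcard : P.card = (partials dom ok vs).length := by
    rw [← List.toFinset_card_of_nodup (nodup_partials (ok := ok) (vs := vs) hdom)]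
    refine Finset.card_image_of_injOn fun f hf g hg hfg => ?_
    rw [Finset.mem_coe, List.mem_toFinset] at hf hg
    rw [PMap.eq_map_val (f := f) (by rwa [hkeys f hf]),
      PMap.eq_map_val (f := g) (by rwa [hkeys g hg]), hkeys f hf, hkeys g hg]
    refine List.map_congr_left fun v hv => ?_
    obtain ⟨a, -, rfl⟩ := hvs v hv
    rw [show PMap.val f (e a) = PMap.val g (e a) from congrFun hfg a]
  have hzero : ∀ φ ∈ P, ∀ a, (e a : ℕ) ∉ vs → φ a = 0 := fun φ hφ a ha => by
    obtain ⟨f, hf, rfl⟩ := Finset.mem_image.1 hφ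
    exact PMap.val_eq_zero (by rwa [hkeys f (List.mem_toFinset.1 hf)])
  have hbound := card_le_prod_card_restrict_rpow (fun E : H.edgeSet => (E : Set A)) Finset.univ
    (fun E => (D.guard t E : ℝ)) (fun E _ => NNReal.coe_nonneg _)
    (Finset.univ.filter fun a => (e a : ℕ) ∈ vs) (fun a ha => by
      obtain ⟨b, hb, hab⟩ := hvs _ (Finset.mem_filter.1 ha).2
      obtain rfl : b = a := e.injective (Fin.ext hab)
      have h1 := D.blocked t b hb
      rw [tsum_fintype, ← ENNReal.ofNNReal_finsetSum, ENNReal.one_le_coe_iff,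
        ← Finset.sum_subtype (Finset.univ.filter fun E : H.edgeSet => b ∈ (E : Set A)) (by simp)
          (fun E => D.guard t E)] at h1
      exact_mod_cast h1) P fun f hf g hg h => by
        funext a
        by_cases ha : (e a : ℕ) ∈ vs
        · exact h a (by simpa using ha)
        · rw [hzero f hf a ha, hzero g hg a ha]
  have hsmall : ∀ E ∈ H.edgeSet, ∀ _ : DecidableEq (E → ℕ),
      (P.image E.domRestrict).card ≤ N := by
    intro E hEm _
    obtain ⟨n, a, rb, rfl, hlen, hrb, h⟩ := hE E hEm
    have hidx : ∀ x : Set.range a, ∃ i, a i = x := fun x => x.2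
    choose idx hidx using hidx
    -- The restriction of a compatible map to the hyperedge can be read off the tuple `u` with which
    -- it agrees. As an element may occur several times in `a`, one position is chosen for each.
    let G : List ℕ → Set.range a → ℕ := fun u x => if (e x : ℕ) ∈ vs then u.getD (idx x) 0 else 0
    have hsub : P.image (Set.range a).domRestrict ⊆ rb.toFinset.image G := by
      intro φ hφ
      obtain ⟨ψ, hψ, rfl⟩ := Finset.mem_image.1 hφ
      obtain ⟨f, hf, rfl⟩ := Finset.mem_image.1 hψ
      rw [List.mem_toFinset] at hf
      obtain ⟨u, hu, hagree⟩ := h f ((mem_partials hok).1 hf).1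
      refine Finset.mem_image.2 ⟨u, List.mem_toFinset.2 hu, funext fun x => ?_⟩
      change (if (e x : ℕ) ∈ vs then u.getD (idx x) 0 else 0) = PMap.val f (e x)
      split_ifs with hx
      · have h1 : ((e x : ℕ), u.getD (idx x) 0) ∈
            (List.ofFn fun i => (e (a i) : ℕ)).zip u := by
          have hi : (idx x : ℕ) < u.length := by rw [hlen u hu]; exact (idx x).2
          refine List.mem_iff_getElem.2 ⟨idx x, by simp [hi], ?_⟩
          simp [hidx, hi]
        exact agree_iff.1 hagree _ h1 _ (PMap.mk_val_mem (by rwa [hkeys f hf])) rfl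
      · exact (PMap.val_eq_zero (by rwa [hkeys f hf])).symm
    have h1 := Finset.card_le_card hsub
    have h2 := Finset.card_image_le (s := rb.toFinset) (f := G)
    have h3 := List.toFinset_card_le rb
    omega
  rw [← hcard]
  clear hzero hcard hkeys
  clear_value P
  have hsum : ∑ E : H.edgeSet, (D.guard t E : ℝ) ≤ r := by
    have h1 : ∑' E : H.edgeSet, (D.guard t E : ℝ≥0∞) ≤ r := (le_iSup
      (fun t => ∑' E : H.edgeSet, (D.guard t E : ℝ≥0∞)) t).trans hr
    rw [tsum_fintype, ← ENNReal.ofNNReal_finsetSum] at h1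
    have h2 : ∑ E : H.edgeSet, D.guard t E ≤ (r : ℝ≥0) := by exact_mod_cast h1
    exact_mod_cast h2
  -- Monotonicity in the exponent needs a base of at least `1`; this is why the cap uses the number
  -- of tuples plus one.
  have hN' : (1 : ℝ) ≤ N := by exact_mod_cast hN
  have hfin : (P.card : ℝ) ≤ (N : ℝ) ^ r := by
    calc (P.card : ℝ) ≤ _ := hbound
      _ ≤ ∏ E : H.edgeSet, (N : ℝ) ^ (D.guard t E : ℝ) :=
        Finset.prod_le_prod (fun E _ => Real.rpow_nonneg (Nat.cast_nonneg _) _) fun E _ =>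
          Real.rpow_le_rpow (Nat.cast_nonneg _) (by exact_mod_cast hsmall E E.2 _) (NNReal.coe_nonneg _)
      _ = (N : ℝ) ^ (∑ E : H.edgeSet, (D.guard t E : ℝ)) :=
        (Real.rpow_sum_of_pos (by linarith) _ _).symm
      _ ≤ (N : ℝ) ^ (r : ℝ) := Real.rpow_le_rpow_of_exponent_le hN' hsum
      _ = (N : ℝ) ^ r := Real.rpow_natCast _ _
  exact_mod_cast hfin

/-- The words are long enough to name every subset of the `k` elements. -/
theorem le_hashSize (k : ℕ) : k ≤ hashSize k := by
  unfold hashSize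
  nlinarith

/-- If the consistency test succeeds, then there is a function all of whose restrictions to bags
satisfy the constraints. -/
theorem exists_of_solvable (e : A ≃ Fin k) {H : Hypergraph A} (hH : H.vertexSet = Set.univ)
    (D : FracHypertreeDecomp H) (hok : ∀ p f, ok (p :: f) = true → ok f = true) {M n pad : ℕ}
    (hpad : padSize k ≤ pad) (hM : ∀ t (vs : List ℕ), vs.Nodup →
      (∀ v ∈ vs, ∃ a ∈ D.bag t, (e a : ℕ) = v) → (partials (List.range n) ok vs).length ≤ M)
    (hsol : solvable M k n ok (allWords pad k) = true) :
    ∃ h : A → ℕ, ∀ t, ∃ f, ok f = true ∧ (∀ p ∈ f, p.2 < n) ∧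
      ∀ a ∈ D.bag t, ((e a : ℕ), h a) ∈ f := by
  classical
  rw [solvable, List.all_eq_true] at hsol
  have hlist : ∀ t, ∃ vs : List ℕ, (∀ v, v ∈ vs ↔ ∃ a ∈ D.bag t, (e a : ℕ) = v) ∧
      ∃ R ∈ consFix (candidates M k n ok (allWords pad k)),
        R ⊆ partials (List.range n) ok vs := by
    intro t
    -- This word has exactly the elements of the bag as its letters below `k`; all other positions
    -- carry the ignored letter `k`.
    let w : PMap := (List.range (hashSize k)).map fun i =>
      (i, if ∃ a ∈ D.bag t, (e a : ℕ) = i then i else k)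
    have hw : w ∈ allWords pad k := by
      refine (mem_allWords hpad).2 ⟨by simp [w, Function.comp_def], fun p hp => ?_⟩
      obtain ⟨i, -, rfl⟩ := List.mem_map.1 hp
      dsimp only
      split_ifs with h
      · obtain ⟨a, -, rfl⟩ := h
        exact (e a).2.le
      · exact le_rfl
    set vs := (List.range k).filter fun v => w.any fun r => decide (r.2 = v)
    have hvs : ∀ v, v ∈ vs ↔ ∃ a ∈ D.bag t, (e a : ℕ) = v := by
      intro v
      simp only [vs, w, List.mem_filter, List.mem_range, List.any_eq_true, List.mem_map,
        decide_eq_true_eq]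
      constructor
      · rintro ⟨hv, _, ⟨i, -, rfl⟩, h⟩
        dsimp only at h
        split_ifs at h with h1
        · exact h ▸ h1
        · omega
      · intro h
        have hv : v < k := by
          obtain ⟨a, -, rfl⟩ := h
          exact (e a).2
        exact ⟨hv, _, ⟨v, hv.trans_le (le_hashSize k), rfl⟩, if_pos h⟩
    have hnd : vs.Nodup := List.nodup_range.filter _
    have hbuild : build M (List.range n) ok vs = partials (List.range n) ok vs :=
      build_eq_partials fun us hus => hM t us (hnd.sublist hus.sublist) fun v hv =>
        (hvs v).1 (hus.subset hv)
    have hmem : partials (List.range n) ok vs ∈ candidates M k n ok (allWords pad k) := by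
      refine List.mem_filter.2 ⟨List.mem_map.2 ⟨w, hw, hbuild⟩, ?_⟩
      exact decide_eq_true (hM t vs hnd fun v hv => (hvs v).1 hv)
    exact ⟨vs, hvs, exists_subset_mem_iterate hmem _⟩
  choose vs hvs R hR hsub using hlist
  have hval : ∀ t, ∀ f ∈ R t, ∀ a ∈ D.bag t, ((e a : ℕ), PMap.val f (e a)) ∈ f :=
    fun t f hf a ha => PMap.mk_val_mem (by
      rw [((mem_partials hok).1 (hsub t hf)).2.1]
      exact (hvs t _).2 ⟨a, ha, rfl⟩)
  -- At each node the total functions that extend a surviving map on the bag are glued.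
  obtain ⟨h, hh⟩ := exists_glue D.isTree D.bag (fun v => D.connected v (hH ▸ Set.mem_univ v))
    (fun t => {φ : A → ℕ | ∃ f ∈ R t, ∀ a ∈ D.bag t, ((e a : ℕ), φ a) ∈ f})
    (fun t => by
      have h1 := hsol _ (hR t)
      obtain ⟨f, hf⟩ := List.exists_mem_of_ne_nil (R t) (by simpa using h1)
      exact ⟨fun a => PMap.val f (e a), f, hf, hval t f hf⟩)
    (fun t s φ ⟨f, hf, hφ⟩ => by
      obtain ⟨g, hg, hfg⟩ := exists_agree_of_mem_consFix (hR t) hf (hR s)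
      exact ⟨fun a => PMap.val g (e a), ⟨g, hg, hval s g hg⟩, fun a hat has =>
        agree_iff.1 hfg _ (hφ a hat) _ (hval s g hg a has) rfl⟩)
  refine ⟨h, fun t => ?_⟩
  obtain ⟨φ, ⟨f, hf, hφ⟩, hhφ⟩ := hh t
  obtain ⟨h1, -, h3⟩ := (mem_partials hok).1 (hsub t hf)
  exact ⟨f, h1, fun p hp => List.mem_range.1 (h3 p hp), fun a ha => hhφ a ha ▸ hφ a ha⟩

/-- The consistency test succeeds if there is a function all of whose restrictions satisfy the
constraints. -/
theorem solvable_of_function (hok : ∀ p f, ok (p :: f) = true → ok f = true) {M n : ℕ}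
    {words : List PMap} (h : ℕ → ℕ) (hlt : ∀ v < k, h v < n)
    (hh : ∀ vs : List ℕ, (∀ v ∈ vs, v < k) → ok (vs.map fun v => (v, h v)) = true) :
    solvable M k n ok words = true := by
  rw [solvable, List.all_eq_true]
  intro R hR
  obtain ⟨f, hf, -⟩ := exists_restriction_mem_iterate (F := candidates M k n ok words) h
    (fun R hR => by
      obtain ⟨hR, hlen⟩ := List.mem_filter.1 hR
      obtain ⟨w, -, rfl⟩ := List.mem_map.1 hR
      set vs := (List.range k).filter fun v => w.any fun r => decide (r.2 = v)
      have hvs : ∀ v ∈ vs, v < k := fun v hv => List.mem_range.1 (List.mem_of_mem_filter hv)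
      refine ⟨vs.map fun v => (v, h v), ?_, by simp⟩
      rw [build_eq_partials_of_length_le (by simpa using hlen)]
      refine (mem_partials hok).2 ⟨hh vs hvs, by simp [Function.comp_def], fun p hp => ?_⟩
      obtain ⟨v, hv, rfl⟩ := List.mem_map.1 hp
      exact List.mem_range.2 (hlt v (hvs v hv))) _ R hR
  cases R with
  | nil => simp at hf
  | cons _ _ => rfl

end

/-! ### Correctness of the algorithm -/

theorem tupleOk_of_cons {cs : List (List ℕ × List (List ℕ))} {p : ℕ × ℕ} {f : PMap}
    (h : tupleOk cs (p :: f) = true) : tupleOk cs f = true := by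
  simp only [tupleOk, List.all_eq_true, List.any_eq_true] at h ⊢
  intro x hx
  obtain ⟨u, hu, hag⟩ := h x hx
  exact ⟨u, hu, agree_iff.2 fun s hs r hr => agree_iff.1 hag s hs r (List.mem_cons_of_mem _ hr)⟩

theorem colorOk_iff {q m a : ℕ} {c f : PMap} : colorOk q m a c f = true ↔
    ∀ p ∈ f, ∀ r ∈ c, hash q m a p.2 = r.1 → p.1 = r.2 := by
  rw [colorOk, agree_iff]
  simp only [List.forall_mem_map]

theorem hash_lt {q : ℕ} (hq : 0 < q) (m a b : ℕ) : hash q m a b < q := Nat.mod_lt _ hq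

section

variable {L : FirstOrder.Language.{0, 0}} {A B : Type} {k n : ℕ}

theorem mem_constraints {syms : List (RelSym L)} {eA : A ≃ Fin k} {eB : B ≃ Fin n}
    {tA : (R : RelSym L) → List (Fin R.1 → A)} {tB : (R : RelSym L) → List (Fin R.1 → B)}
    {x : List ℕ × List (List ℕ)} :
    x ∈ constraints (structCode syms eA tA).2 (structCode syms eB tB).2 ↔
      ∃ R ∈ syms, ∃ a ∈ tA R, x = (List.ofFn fun i => (eA (a i) : ℕ),
        (tB R).map fun b => List.ofFn fun i => (eB (b i) : ℕ)) := by
  rw [constraints, structCode, structCode, List.zip_map']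
  simp only [List.mem_flatMap, List.mem_map]
  constructor
  · rintro ⟨_, ⟨R, hR, rfl⟩, t, ht, rfl⟩
    obtain ⟨a, ha, rfl⟩ := List.mem_map.1 ht
    exact ⟨R, hR, a, ha, rfl⟩
  · rintro ⟨R, hR, a, ha, rfl⟩
    exact ⟨_, ⟨R, hR, rfl⟩, _, List.mem_map_of_mem ha, rfl⟩

theorem zip_ofFn {α β : Type} {m : ℕ} (f : Fin m → α) (g : Fin m → β) :
    (List.ofFn f).zip (List.ofFn g) = List.ofFn fun i => (f i, g i) := by
  simp only [List.ofFn_eq_map, List.zip_map']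

variable [L.Structure A] [L.Structure B]

open FirstOrder.Language.Structure (RelMap)

/-- An embedding is found, provided that all words are enumerated. -/
theorem solve_of_embedding (r : ℕ) {syms : List (RelSym L)} {eA : A ≃ Fin k} {eB : B ≃ Fin n}
    {tA : (R : RelSym L) → List (Fin R.1 → A)} {tB : (R : RelSym L) → List (Fin R.1 → B)}
    (hA : ∀ R a, a ∈ tA R ↔ RelMap R.2 a) (hB : ∀ R b, b ∈ tB R ↔ RelMap R.2 b)
    (g : L.Hom A B) (hg : Function.Injective g) :
    solve r (padSize k) (structCode syms eA tA) (structCode syms eB tB) = true := by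
  classical
  let φ : Fin k → ℕ := fun v => (eB (g (eA.symm v)) : ℕ)
  have hφ : Function.Injective φ := fun v w h =>
    eA.symm.injective (hg (eB.injective (Fin.ext h)))
  obtain ⟨m, hm, a, ha, hinj⟩ := exists_hash_injective (n := n) φ hφ fun v => (eB _).2
  let h : ℕ → ℕ := fun v => if hv : v < k then φ ⟨v, hv⟩ else 0
  have hh : ∀ x, h (eA x) = eB (g x) := fun x => by
    simp only [h, (eA x).2, dif_pos, φ, Fin.eta, Equiv.symm_apply_apply]
  -- The colouring inverts the hash function on the image of the embedding. Hash values that are not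
  -- attained get the spare letter `k`.
  let c : PMap := (List.range (hashSize k)).map fun j =>
    (j, if hj : ∃ v : Fin k, hash (hashSize k) m a (φ v) = j then (hj.choose : ℕ) else k)
  have hc : c ∈ allWords (padSize k) k := by
    refine (mem_allWords le_rfl).2 ⟨by simp [c, Function.comp_def], fun p hp => ?_⟩
    obtain ⟨j, -, rfl⟩ := List.mem_map.1 hp
    dsimp only
    split_ifs with hj
    · exact hj.choose.2.le
    · exact le_rfl
  refine List.any_eq_true.2 ⟨m, List.mem_range.2 hm, List.any_eq_true.2 ⟨a, List.mem_range.2 ha,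
    List.any_eq_true.2 ⟨c, hc, solvable_of_function ?_ h ?_ ?_⟩⟩⟩
  · intro p f hpf
    rw [Bool.and_eq_true] at hpf ⊢
    exact ⟨tupleOk_of_cons hpf.1, colorOk_iff.2 fun s hs =>
      colorOk_iff.1 hpf.2 s (List.mem_cons_of_mem _ hs)⟩
  · intro v hv
    have hv : v < k := hv
    simp only [h, hv, dif_pos]
    exact (eB _).2
  · intro vs hvs
    rw [Bool.and_eq_true]
    constructor
    · simp only [tupleOk, List.all_eq_true, List.any_eq_true]
      intro x hx
      obtain ⟨R, -, b, hb, rfl⟩ := mem_constraints.1 hx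
      refine ⟨_, List.mem_map_of_mem ((hB R (g ∘ b)).2 (g.map_rel R.2 b ((hA R b).1 hb))), ?_⟩
      rw [zip_ofFn, agree_iff]
      intro s hs p hp hsp
      obtain ⟨i, rfl⟩ := (List.mem_ofFn' _ _).1 hs
      obtain ⟨v, -, rfl⟩ := List.mem_map.1 hp
      dsimp only at hsp ⊢
      rw [← hsp, hh, Function.comp_apply]
    · rw [colorOk_iff]
      intro p hp s hs hps
      obtain ⟨v, hv, rfl⟩ := List.mem_map.1 hp
      obtain ⟨j, -, rfl⟩ := List.mem_map.1 hs
      have hv : v < k := hvs v hv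
      dsimp only at hps ⊢
      simp only [h, hv, dif_pos] at hps
      have hj : ∃ w : Fin k, hash (hashSize k) m a (φ w) = j := ⟨⟨v, hv⟩, hps⟩
      rw [dif_pos hj]
      have := hinj (hj.choose_spec.trans hps.symm)
      rw [this]

/-- If the algorithm succeeds then there is an embedding, provided that the hypergraph of the first
structure has a decomposition of small width. -/
theorem embedding_of_solve [L.IsRelational] {r : ℕ} {syms : List (RelSym L)}
    (hsyms : ∀ R, R ∈ syms) {eA : A ≃ Fin k} {eB : B ≃ Fin n}
    {tA : (R : RelSym L) → List (Fin R.1 → A)} {tB : (R : RelSym L) → List (Fin R.1 → B)}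
    (hA : ∀ R a, a ∈ tA R ↔ RelMap R.2 a) (hB : ∀ R b, b ∈ tB R ↔ RelMap R.2 b)
    (D : FracHypertreeDecomp (hypergraphOf L A)) (hD : D.width ≤ r)
    (hsol : solve r (padSize k) (structCode syms eA tA) (structCode syms eB tB) = true) :
    ∃ g : L.Hom A B, Function.Injective g := by
  have : Finite A := Finite.of_equiv _ eA.symm
  obtain ⟨m, -, hsol⟩ := List.any_eq_true.1 hsol
  obtain ⟨s, -, hsol⟩ := List.any_eq_true.1 hsol
  obtain ⟨c, hc, hsol⟩ := List.any_eq_true.1 hsol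
  change c ∈ allWords (padSize k) k at hc
  set CA := structCode syms eA tA
  set CB := structCode syms eB tB
  set ok : PMap → Bool := fun f =>
    tupleOk (constraints CA.2 CB.2) f && colorOk (hashSize k) m s c f
  have hok : ∀ p f, ok (p :: f) = true → ok f = true := by
    intro p f hpf
    simp only [ok] at hpf ⊢
    rw [Bool.and_eq_true] at hpf ⊢
    exact ⟨tupleOk_of_cons hpf.1, colorOk_iff.2 fun s hs =>
      colorOk_iff.1 hpf.2 s (List.mem_cons_of_mem _ hs)⟩
  have htuple : ∀ (R : RelSym L) (a : Fin R.1 → A), RelMap R.2 a → ∀ f, ok f = true →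
      ∃ b ∈ tB R, agree (List.ofFn fun i => ((eA (a i) : ℕ), (eB (b i) : ℕ))) f = true := by
    intro R a ha f hf
    have h1 := (Bool.and_eq_true_iff.1 hf).1
    simp only [tupleOk, List.all_eq_true, List.any_eq_true] at h1
    obtain ⟨u, hu, hag⟩ := h1 _ (mem_constraints.2 ⟨R, hsyms R, a, (hA R a).2 ha, rfl⟩)
    obtain ⟨b, hb, rfl⟩ := List.mem_map.1 hu
    exact ⟨b, hb, by rwa [zip_ofFn] at hag⟩
  -- A tuple that spans the hyperedge restricts compatible maps to the tuples of the same relation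
  -- in the target, which gives the factor for this edge in the fractional edge cover bound.
  have hE : ∀ E ∈ (hypergraphOf L A).edgeSet, ∃ (n : ℕ) (a : Fin n → A) (rb : List (List ℕ)),
      E = Set.range a ∧ (∀ u ∈ rb, u.length = n) ∧ rb.length ≤ CB.2.flatten.length + 1 ∧
        ∀ f, ok f = true → ∃ u ∈ rb,
          agree ((List.ofFn fun i => (eA (a i) : ℕ)).zip u) f = true := by
    rintro E ⟨R, a, ha, rfl⟩
    refine ⟨R.1, a, (tB R).map fun b => List.ofFn fun i => (eB (b i) : ℕ), rfl, ?_, ?_, ?_⟩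
    · intro u hu
      obtain ⟨b, -, rfl⟩ := List.mem_map.1 hu
      exact List.length_ofFn
    · have h1 : ((tB R).map fun b => List.ofFn fun i => (eB (b i) : ℕ)) ∈ CB.2 :=
        List.mem_map_of_mem (f := fun R => (tB R).map fun b => List.ofFn fun i => (eB (b i) : ℕ))
          (hsyms R)
      exact (List.sublist_flatten_of_mem h1).length_le.trans (Nat.le_succ _)
    · intro f hf
      obtain ⟨b, hb, hag⟩ := htuple R a ha f hf
      exact ⟨_, List.mem_map_of_mem hb, by rwa [zip_ofFn]⟩
  obtain ⟨h, hh⟩ := exists_of_solvable eA rfl D hok le_rfl (fun t vs hnd hvs =>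
    length_partials_le_pow eA D List.nodup_range hok (Nat.le_add_left 1 _) hD hE t hnd hvs) hsol
  have hnode : ∀ a, ∃ t, a ∈ D.bag t := fun a => by
    obtain ⟨t⟩ := (D.connected a (Set.mem_univ a)).nonempty
    exact ⟨t, t.2⟩
  have hlt : ∀ a, h a < n := fun a => by
    obtain ⟨t, ht⟩ := hnode a
    obtain ⟨f, -, h2, h3⟩ := hh t
    exact h2 _ (h3 a ht)
  -- The colour of the hash value of `h a` is `a`, so `h a` determines `a`; the colouring is defined
  -- on all hash values.
  have hcol : ∀ a, ∀ p ∈ c, hash (hashSize k) m s (h a) = p.1 → (eA a : ℕ) = p.2 := fun a => by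
    obtain ⟨t, ht⟩ := hnode a
    obtain ⟨f, h1, -, h3⟩ := hh t
    exact colorOk_iff.1 (Bool.and_eq_true_iff.1 h1).2 _ (h3 a ht)
  refine ⟨⟨fun a => eB.symm ⟨h a, hlt a⟩, fun f => isEmptyElim f, fun {l} R a ha => ?_⟩,
    fun a a' haa => ?_⟩
  · have ha : RelMap (⟨l, R⟩ : RelSym L).2 a := ha
    -- All entries of the tuple lie in one bag, where `h` is part of a single compatible map `f`.
    -- The tuple `b` that witnesses compatibility must then be the image of `a`.
    obtain ⟨t, ht⟩ := D.edge_covered (Set.range a) ⟨⟨l, R⟩, a, ha, rfl⟩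
    obtain ⟨f, h1, -, h3⟩ := hh t
    obtain ⟨b, hb, hag⟩ := htuple ⟨l, R⟩ a ha f h1
    have hb' : (fun i => eB.symm ⟨h (a i), hlt (a i)⟩) = b := by
      funext i
      have := agree_iff.1 hag _ ((List.mem_ofFn' _ _).2 ⟨i, rfl⟩) _
        (h3 (a i) (ht ⟨i, rfl⟩)) rfl
      rw [Equiv.symm_apply_eq]
      exact Fin.ext this.symm
    have h4 := (hB ⟨l, R⟩ b).1 hb
    rw [← hb'] at h4
    exact h4
  · have h1 : h a = h a' := by
      have : eB.symm ⟨h a, hlt a⟩ = eB.symm ⟨h a', hlt a'⟩ := haa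
      simpa using this
    obtain ⟨h2, -⟩ := (mem_allWords le_rfl).1 hc
    have h3 : hash (hashSize k) m s (h a) ∈ c.map Prod.fst := by
      rw [h2, List.mem_range]
      exact hash_lt (hashSize_pos k) _ _ _
    obtain ⟨p, hp, hpe⟩ := List.mem_map.1 h3
    have h4 := hcol a p hp hpe.symm
    have h5 := hcol a' p hp (h1 ▸ hpe.symm)
    exact eA.injective (Fin.ext (h4.trans h5.symm))

end

/-- The program decides the embedding problem within the time bound. -/
theorem exists_decidedBy (𝓗 : HypergraphClass) (h𝓗 : 𝓗.BoundedFHW) :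
    ∃ (p : Prog) (C c : ℕ), (EMB 𝓗).DecidedBy p fun I : EmbInstance 𝓗 =>
      C * 2 ^ (I.sizeA ^ c) * (I.sizeB + 1) ^ c := by
  obtain ⟨r₀, hr₀⟩ := h𝓗
  -- The strict inequality yields an actual decomposition of width below `r`, so it does not matter
  -- whether the infimum is attained.
  obtain ⟨r, hr⟩ := exists_nat_gt r₀
  obtain ⟨p, c, hp⟩ := exists_prog_solve r
  obtain ⟨C, d, hCd⟩ := time_bound c
  refine ⟨p, C, d, ?_⟩
  rintro (I : EmbInstance 𝓗) x
    ⟨syms, a, b, hnd, hmem, ⟨kA, eA, tA, ndA, hA, rfl⟩, ⟨kB, eB, tB, ndB, hB, rfl⟩, rfl⟩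
  have := I.relational
  have := I.finite_sym
  obtain ⟨n, hn, hrun⟩ := hp (structCode syms eA tA) (structCode syms eB tB)
  obtain ⟨h1, h2⟩ := sz_structCode_le syms hnd hmem eA tA ndA hA
  obtain ⟨-, h3⟩ := sz_structCode_le syms hnd hmem eB tB ndB hB
  refine ⟨enc (solve r (padSize kA) (structCode syms eA tA) (structCode syms eB tB)), n, ?_,
    hn.trans (hCd _ _ _ I.sizeA I.sizeB h1 h2 h3), ?_⟩
  · rw [← enc_structCode, ← enc_structCode]
    exact hrun
  change enc (solve r (padSize kA) (structCode syms eA tA) (structCode syms eB tB)) ≠ .nil ↔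
    ∃ h : FirstOrder.Language.Hom I.L I.A I.B, Function.Injective h
  constructor
  · intro hne
    have hsol : solve r (padSize kA) (structCode syms eA tA) (structCode syms eB tB) = true := by
      by_contra hf
      rw [Bool.not_eq_true] at hf
      exact hne (by rw [hf]; rfl)
    have hw : fhw (hypergraphOf I.L I.A) < r :=
      (hr₀ _ _ I.mem_class).trans_lt (by exact_mod_cast hr)
    obtain ⟨D, hD⟩ := iInf_lt_iff.1 hw
    exact embedding_of_solve hmem hA hB D hD.le hsol
  · rintro ⟨g, hg⟩
    rw [solve_of_embedding r hA hB g hg]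
    simp

end EmbFPT

/-! ### The main theorem -/

theorem mainTheorem11 (𝓗 : EmbFPT.HypergraphClass) (h𝓗 : 𝓗.BoundedFHW) :
    (EmbFPT.EMB 𝓗).FPT ∧
    ∃ (p : EmbFPT.Prog) (C c : ℕ), (EmbFPT.EMB 𝓗).DecidedBy p fun I : EmbFPT.EmbInstance 𝓗 =>
      C * 2 ^ (I.sizeA ^ c) * (I.sizeB + 1) ^ c := by
  obtain ⟨p, C, c, h⟩ := EmbFPT.exists_decidedBy 𝓗 h𝓗
  refine ⟨⟨p, fun k => C * 2 ^ (k ^ c), c, ?_, fun I x hx => ?_⟩, p, C, c, h⟩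
  · have hpow : Primrec₂ fun m n : ℕ => m ^ n := Primrec₂.unpaired'.1 Nat.Primrec.pow
    exact (Primrec.nat_mul.comp (Primrec.const C)
      (hpow.comp (Primrec.const 2) (hpow.comp .id (Primrec.const c)))).to_comp
  · obtain ⟨y, n, h1, h2, h3⟩ := h I x hx
    exact ⟨y, n, h1, h2.trans (Nat.mul_le_mul_left _ (Nat.pow_le_pow_left
      (Nat.succ_le_succ (Nat.le_add_left I.sizeB I.sizeA)) c)), h3⟩
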